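/- Fix a set of additive charges (particle numbers, electric charges, ...). A *system* is a separable complex Hilbert space $\mathcal H$ together with an orthogonal decomposition into closed superselection sectors, the joint eigenspaces of the charges $Q_\alpha$ (with real eigenvalues). The compound of two systems has Hilbert space $\mathcal H_A\otimes\mathcal H_B$ and each of its charges is the sum of the charges of its parts; $\mathcal H^{\otimes n}$ is the compound of $n\ge 1$ copies. A *state* $\rho$ is a density matrix (positive operator of trace one) that is block-diagonal with respect to the sectors. A *QLB state* $\pi(N)=\frac1N P_N$ is a state given by a projector $P_N$ onto a subspace of finite dimension $N\geq 1$ of a single sector. Let $\mathcal C$ be a class of systems that is closed under forming compound systems and contains a system with an infinite-dimensional sector. **Theorem (von Neumann entropy).** Let $S$ assign to each state of each system in $\mathcal C$ a value in $[0,\infty]$. Then $S$ satisfies the axioms A-F below if and only if there is a constant $k_B\in(0,\infty)$ such that $$S(\rho)=S_{vN}(\rho)=-k_B\,\mathrm{Tr}\,\rho\ln\rho$$ for every state $\rho$ of every system in $\mathcal C$. - **A (decomposition).** $S(\rho_A\otimes|\psi_B\rangle\langle\psi_B|)=S(\rho_A)$ and $S(|\psi_A\rangle\langle\psi_A|\otimes\rho_B)=S(\rho_B)$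 for all states $\rho_A,\rho_B$ and all pure states $|\psi_A\rangle\langle\psi_A|$, $|\psi_B\rangle\langle\psi_B|$. - **B (unitary invariance).** $S(U\rho U^*)=S(\rho)$ for all unitaries $U$ that commute with all charges. - **C (monotonicity).** If $M>N$ then $S(\pi(M))>S(\pi(N))$ for all QLB states $\pi(M)$, $\pi(N)$ of systems in $\mathcal C$. - **D (extensivity).** $S(\rho^{\otimes n})=n\,S(\rho)$ for all states $\rho$ and all $n\ge1$. - **E (rational combinatorics).** If $\rho$ has finite rank and only rational eigenvalues, then $$S(\rho)=\sup_{n,\Omega}\tfrac1n S(\Omega),$$ where $n\ge1$ runs over the common multiples of the denominators of the eigenvalues of $\rho$, and $\Omega$ over the QLB states on $\mathcal H^{\otimes n}$ such that for each $k=1,\dots,n$ the partial trace of $\Omega$ over all factors except the $k$-th one equals $\rho$. - **F (semicontinuity).** $S$ is lower semicontinuous with respect to the trace norm on the states of each system, and for every state $\rho$ $$S(\rho)=\inf\Big\{\lim_{j\to\infty}S(\sigma_j)\Big\},$$ the infimum being over all sequences of states $\sigma_j$ of the same system, of finite rank and with only rational eigenvalues, such that $\sigma_j\to\rho$ in trace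 norm and $\lim_j S(\sigma_j)$ exists in $[0,\infty]$. -/

import Mathlib

open scoped TensorProduct ENNReal Topology InnerProductSpace
open Filter UniformSpace

universe v u

/-- A quantum system: a separable complex Hilbert space `H` decomposed into superselection sectors.
The charges (particle numbers, electric charge, ...) are labelled by `α`; for `q : α → ℝ`, the
subspace `sector q` is the joint eigenspace on which every charge `a` takes the value `q a`. The
sectors are closed, mutually orthogonal and span a dense subspace; most of them are usually zero. -/
structure QSystem (α : Type v) where
  /-- The underlying Hilbert space. -/
  H : Type u
  [normed : NormedAddCommGroup H]
  [innerProd : InnerProductSpace ℂ H]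
  [complete : CompleteSpace H]
  [separable : TopologicalSpace.SeparableSpace H]
  /-- The joint eigenspaces of the charges. -/
  sector : (α → ℝ) → Submodule ℂ H
  isClosed_sector : ∀ q, IsClosed (sector q : Set H)
  isOrtho_sector : ∀ p q, p ≠ q → sector p ⟂ sector q
  dense_sector : (⨆ q, sector q).topologicalClosure = ⊤

attribute [instance] QSystem.normed QSystem.innerProd QSystem.complete QSystem.separable

/-- The bounded operator `T ⊗ R` on the Hilbert space tensor product, which is the completion of
the algebraic tensor product. -/
noncomputable def hilbertTensorOp {E : Type u} {F : Type u}
    [NormedAddCommGroup E] [InnerProductSpace ℂ E] [NormedAddCommGroup F] [InnerProductSpace ℂ F]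
    (T : E →L[ℂ] E) (R : F →L[ℂ] F) :
    Completion (E ⊗[ℂ] F) →L[ℂ] Completion (E ⊗[ℂ] F) :=
  (TensorProduct.mapL T R).completion

namespace QSystem

variable {α : Type v}

theorem separableSpace_tensor (A B : QSystem.{v, u} α) :
    TopologicalSpace.SeparableSpace (A.H ⊗[ℂ] B.H) := by
  have h1 : TopologicalSpace.IsSeparable
      (Set.range fun x : A.H × B.H => x.1 ⊗ₜ[ℂ] x.2) :=
    TopologicalSpace.isSeparable_range TensorProduct.continuous_tmul
  have h2 := h1.span (R := ℂ)
  have h3 : (Submodule.span ℂ (Set.range fun x : A.H × B.H => x.1 ⊗ₜ[ℂ] x.2)) = ⊤ := by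
    rw [← TensorProduct.span_tmul_eq_top ℂ A.H B.H]
    congr 1
    ext z
    simp
  rw [h3] at h2
  exact TopologicalSpace.isSeparable_univ_iff.1 h2

/-- The elementary tensor `x ⊗ y` in the Hilbert space tensor product. -/
noncomputable def tmul (A B : QSystem.{v, u} α) (x : A.H) (y : B.H) :
    Completion (A.H ⊗[ℂ] B.H) :=
  ((x ⊗ₜ[ℂ] y : A.H ⊗[ℂ] B.H) : Completion (A.H ⊗[ℂ] B.H))

/-- The sectors of a compound system: every charge is the sum of the charges of the two parts. -/
noncomputable def tensorSector (A B : QSystem.{v, u} α) (q : α → ℝ) :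
    Submodule ℂ (Completion (A.H ⊗[ℂ] B.H)) :=
  (Submodule.span ℂ {z | ∃ p r, p + r = q ∧
    ∃ x ∈ A.sector p, ∃ y ∈ B.sector r, z = tmul A B x y}).topologicalClosure

theorem tensorSector_isOrtho (A B : QSystem.{v, u} α) (p q : α → ℝ) (hpq : p ≠ q) :
    tensorSector A B p ⟂ tensorSector A B q := by
  have key : ∀ p q : α → ℝ, p ≠ q →
      Submodule.span ℂ {z | ∃ s r, s + r = p ∧
        ∃ x ∈ A.sector s, ∃ y ∈ B.sector r, z = tmul A B x y} ⟂
      Submodule.span ℂ {z | ∃ s r, s + r = q ∧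
        ∃ x ∈ A.sector s, ∃ y ∈ B.sector r, z = tmul A B x y} := by
    intro p q hpq
    rw [Submodule.isOrtho_span]
    rintro _ ⟨s, r, rfl, x, hx, y, hy, rfl⟩ _ ⟨s', r', rfl, x', hx', y', hy', rfl⟩
    simp only [tmul, Completion.inner_coe, TensorProduct.inner_tmul]
    by_cases hs : s = s'
    · have hr : r ≠ r' := by
        rintro rfl
        exact hpq (by rw [hs])
      rw [(Submodule.isOrtho_iff_inner_eq.1 (B.isOrtho_sector _ _ hr)) y hy y' hy', mul_zero]
    · rw [(Submodule.isOrtho_iff_inner_eq.1 (A.isOrtho_sector _ _ hs)) x hx x' hx', zero_mul]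
  have h1 := key p q hpq
  unfold tensorSector
  rw [Submodule.IsOrtho] at h1 ⊢
  refine Submodule.topologicalClosure_minimal _ ?_ (Submodule.isClosed_orthogonal _)
  rwa [Submodule.orthogonal_closure]

theorem tensorSector_dense (A B : QSystem.{v, u} α) :
    (⨆ q, tensorSector A B q).topologicalClosure = ⊤ := by
  set M := (⨆ q, tensorSector A B q).topologicalClosure with hM
  have hMc : IsClosed (M : Set (Completion (A.H ⊗[ℂ] B.H))) :=
    Submodule.isClosed_topologicalClosure _
  let L : A.H →L[ℂ] B.H →L[ℂ] (A.H ⊗[ℂ] B.H) := TensorProduct.mkL ℂ A.H B.H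
  let C : (A.H ⊗[ℂ] B.H) →L[ℂ] Completion (A.H ⊗[ℂ] B.H) := Completion.toComplL
  have h0 : ∀ p r, ∀ x ∈ A.sector p, ∀ y ∈ B.sector r, C (L x y) ∈ M := by
    intro p r x hx y hy
    refine Submodule.le_topologicalClosure _ ?_
    refine Submodule.mem_iSup_of_mem (p + r) ?_
    refine Submodule.le_topologicalClosure _ (Submodule.subset_span ?_)
    exact ⟨p, r, rfl, x, hx, y, hy, rfl⟩
  have h1 : ∀ p, ∀ x ∈ A.sector p, ∀ y, C (L x y) ∈ M := by
    intro p x hx y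
    have hc : IsClosed ((M.comap (C.comp (L x)).toLinearMap : Submodule ℂ B.H) : Set B.H) :=
      hMc.preimage (C.comp (L x)).continuous
    have hle : (⨆ q, B.sector q).topologicalClosure ≤ M.comap (C.comp (L x)).toLinearMap :=
      Submodule.topologicalClosure_minimal _ (iSup_le fun r y hy => h0 p r x hx y hy) hc
    rw [B.dense_sector] at hle
    exact hle (Submodule.mem_top (x := y))
  have h2 : ∀ x y, C (L x y) ∈ M := by
    intro x y
    have hc : IsClosed ((M.comap (C.comp (L.flip y)).toLinearMap : Submodule ℂ A.H) : Set A.H) :=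
      hMc.preimage (C.comp (L.flip y)).continuous
    have hle : (⨆ q, A.sector q).topologicalClosure ≤ M.comap (C.comp (L.flip y)).toLinearMap :=
      Submodule.topologicalClosure_minimal _ (iSup_le fun p x hx => h1 p x hx y) hc
    rw [A.dense_sector] at hle
    exact hle (Submodule.mem_top (x := x))
  have h3 : ∀ z : A.H ⊗[ℂ] B.H, C z ∈ M := by
    intro z
    induction z with
    | zero => simp
    | tmul x y => exact h2 x y
    | add x y hx hy => rw [map_add]; exact M.add_mem hx hy
  have h4 : ∀ z : Completion (A.H ⊗[ℂ] B.H), z ∈ M := by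
    intro z
    induction z using Completion.induction_on with
    | hp => exact hMc
    | ih z => exact h3 z
  exact eq_top_iff.2 fun z _ => h4 z

/-- The compound system `A ⊗ B`. -/
noncomputable def tensor (A B : QSystem.{v, u} α) : QSystem.{v, u} α :=
  haveI := separableSpace_tensor A B
  { H := Completion (A.H ⊗[ℂ] B.H)
    sector := tensorSector A B
    isClosed_sector := fun _ => Submodule.isClosed_topologicalClosure _
    isOrtho_sector := tensorSector_isOrtho A B
    dense_sector := tensorSector_dense A B }

/-- `A.pow n` is the compound system of `n + 1` versions of `A`, i.e. `A ^ ⊗ (n + 1)`. -/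
noncomputable def pow (A : QSystem.{v, u} α) : ℕ → QSystem.{v, u} α
  | 0 => A
  | n + 1 => (pow A n).tensor A

/-- The product operator `T ⊗ R` on a compound system. -/
noncomputable def tensorOp {A B : QSystem.{v, u} α} (T : A.H →L[ℂ] A.H) (R : B.H →L[ℂ] B.H) :
    (A.tensor B).H →L[ℂ] (A.tensor B).H :=
  hilbertTensorOp T R

/-- `T ⊗ ⋯ ⊗ T` with `n + 1` factors. -/
noncomputable def powOp {A : QSystem.{v, u} α} (T : A.H →L[ℂ] A.H) :
    (n : ℕ) → ((A.pow n).H →L[ℂ] (A.pow n).H)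
  | 0 => T
  | n + 1 => tensorOp (A := A.pow n) (B := A) (powOp T n) T

/-- The one-site operator `1 ⊗ ⋯ ⊗ X ⊗ ⋯ ⊗ 1` acting as `X` on the factor number `k` among the
`n + 1` factors. -/
noncomputable def siteOp {A : QSystem.{v, u} α} (X : A.H →L[ℂ] A.H) :
    (n : ℕ) → Fin (n + 1) → ((A.pow n).H →L[ℂ] (A.pow n).H)
  | 0, _ => X
  | n + 1, k => Fin.lastCases
      (motive := fun _ => (A.pow (n + 1)).H →L[ℂ] (A.pow (n + 1)).H)
      (tensorOp (A := A.pow n) (B := A) 1 X)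
      (fun j => tensorOp (A := A.pow n) (B := A) (siteOp X n j) 1) k

/-- `T` maps every superselection sector into itself: it is block-diagonal, i.e. commutes with
all charges. -/
def PreservesSectors (A : QSystem.{v, u} α) (T : A.H →L[ℂ] A.H) : Prop :=
  ∀ q, ∀ x ∈ A.sector q, T x ∈ A.sector q

end QSystem

section Trace

variable {H : Type u} [NormedAddCommGroup H] [InnerProductSpace ℂ H] [CompleteSpace H]

/-- The index set of a chosen Hilbert basis. -/
noncomputable def stdHilbertIndex (H : Type u) [NormedAddCommGroup H] [InnerProductSpace ℂ H]
    [CompleteSpace H] : Set H :=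
  (exists_hilbertBasis ℂ H).choose

/-- A chosen Hilbert basis (orthonormal basis). -/
noncomputable def stdHilbertBasis (H : Type u) [NormedAddCommGroup H] [InnerProductSpace ℂ H]
    [CompleteSpace H] : HilbertBasis (stdHilbertIndex H) ℂ H :=
  (exists_hilbertBasis ℂ H).choose_spec.choose

/-- The trace, in `[0, ∞]`, of a positive bounded operator. -/
noncomputable def posTrace (T : H →L[ℂ] H) : ℝ≥0∞ :=
  ∑' i, ENNReal.ofReal (RCLike.re ⟪stdHilbertBasis H i, T (stdHilbertBasis H i)⟫_ℂ)

/-- The trace of a trace class operator. -/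
noncomputable def opTrace (T : H →L[ℂ] H) : ℂ :=
  ∑' i, ⟪stdHilbertBasis H i, T (stdHilbertBasis H i)⟫_ℂ

/-- The trace norm `Tr |T|`, in `[0, ∞]`. -/
noncomputable def traceNorm (T : H →L[ℂ] H) : ℝ≥0∞ :=
  posTrace (CFC.abs T)

end Trace

namespace QSystem

variable {α : Type v}

/-- The states of a system: density matrices (positive operators of trace one) that are
block-diagonal with respect to the superselection sectors. -/
structure State (A : QSystem.{v, u} α) where
  /-- The density matrix. -/
  op : A.H →L[ℂ] A.H
  isPositive : op.IsPositive
  trace_eq_one : posTrace op = 1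
  preservesSectors : A.PreservesSectors op

namespace State

variable {A : QSystem.{v, u} α}

/-- `ρ = |ψ⟩⟨ψ|` for a unit vector `ψ`. -/
def IsPure (ρ : A.State) : Prop :=
  ∃ ψ : A.H, ‖ψ‖ = 1 ∧ ρ.op = InnerProductSpace.rankOne ℂ ψ ψ

/-- The state is `π(N) = P / N` with `P` the projector onto an `N`-dimensional subspace of a single
superselection sector (a "Quantum Laplace Boltzmann state"). -/
def IsQLB (ρ : A.State) (N : ℕ) : Prop :=
  ∃ (q : α → ℝ) (V : Submodule ℂ A.H) (_ : FiniteDimensional ℂ V),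
    V ≤ A.sector q ∧ Module.finrank ℂ V = N ∧ ρ.op = (N : ℂ)⁻¹ • V.starProjection

/-- Finite rank, and all eigenvalues are rational. -/
def IsRational (ρ : A.State) : Prop :=
  FiniteDimensional ℂ (LinearMap.range ρ.op.toLinearMap) ∧
    ∀ μ : ℂ, Module.End.HasEigenvalue ρ.op.toLinearMap μ → ∃ r : ℚ, μ = (r : ℂ)

/-- `m` is a common multiple of the denominators of the rational eigenvalues. -/
def IsCommonDenominator (ρ : A.State) (m : ℕ) : Prop :=
  ∀ r : ℚ, Module.End.HasEigenvalue ρ.op.toLinearMap (r : ℂ) → r.den ∣ m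

/-- `ω` is the partial trace of the state `Ω` of `n + 1` copies of `A` over all the factors except
the factor number `k`: it gives the same expectation values to all operators on that factor. -/
def IsPartialTrace {n : ℕ} (Ω : (A.pow n).State) (k : Fin (n + 1)) (ω : A.State) : Prop :=
  ∀ X : A.H →L[ℂ] A.H, opTrace (Ω.op * siteOp X n k) = opTrace (ω.op * X)

/-- Von Neumann's entropy `- k Tr (ρ ln ρ)`, in `[0, ∞]`. The operator `- ρ ln ρ` is obtained by the
functional calculus from the continuous function `x ↦ - x ln x`, which is `0` at `0`. -/
noncomputable def vonNeumannEntropy (k : ℝ) (ρ : A.State) : ℝ≥0∞ :=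
  ENNReal.ofReal k * posTrace (cfc (fun x : ℝ => -(x * Real.log x)) ρ.op)

end State

end QSystem

/-- A function assigning a value in `[0, ∞]` to each state of each system. -/
abbrev EntropyFunction (α : Type v) : Type (max v (u + 1)) :=
  ∀ A : QSystem.{v, u} α, A.State → ℝ≥0∞

namespace EntropyFunction

open QSystem

variable {α : Type v}

/-- A) Decomposition. -/
def Decomposition (𝒞 : Set (QSystem.{v, u} α)) (S : EntropyFunction.{v, u} α) : Prop :=
  ∀ A ∈ 𝒞, ∀ B ∈ 𝒞, ∀ (ρ : A.State) (σ : B.State) (τ : (A.tensor B).State),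
    τ.op = tensorOp ρ.op σ.op →
      (σ.IsPure → S (A.tensor B) τ = S A ρ) ∧ (ρ.IsPure → S (A.tensor B) τ = S B σ)

/-- B) Invariance under the unitaries that commute with all charges. -/
def UnitaryInvariance (𝒞 : Set (QSystem.{v, u} α)) (S : EntropyFunction.{v, u} α) : Prop :=
  ∀ A ∈ 𝒞, ∀ (ρ σ : A.State), ∀ U ∈ unitary (A.H →L[ℂ] A.H), A.PreservesSectors U →
    σ.op = U * ρ.op * star U → S A ρ = S A σ

/-- C) Strict monotonicity on QLB states. -/
def Monotonicity (𝒞 : Set (QSystem.{v, u} α)) (S : EntropyFunction.{v, u} α) : Prop :=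
  ∀ A ∈ 𝒞, ∀ B ∈ 𝒞, ∀ (ρ : A.State) (σ : B.State) (M N : ℕ),
    ρ.IsQLB M → σ.IsQLB N → N < M → S B σ < S A ρ

/-- D) Extensivity: `S (ρ ^ ⊗ n) = n * S ρ` for all `n ≥ 1`. -/
def Extensivity (𝒞 : Set (QSystem.{v, u} α)) (S : EntropyFunction.{v, u} α) : Prop :=
  ∀ A ∈ 𝒞, ∀ (ρ : A.State) (n : ℕ) (τ : (A.pow n).State),
    τ.op = powOp ρ.op n → S (A.pow n) τ = ((n + 1 : ℕ) : ℝ≥0∞) * S A ρ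

/-- E) Rational combinatorics with large numbers: for `ρ` with finite rank and rational spectrum,
`S ρ = sup S Ω / n` over all common multiples `n ≥ 1` of the denominators of the eigenvalues and
all QLB states `Ω` of `n` copies with all one-site partial traces equal to `ρ`. -/
def RationalCombinatorics (𝒞 : Set (QSystem.{v, u} α)) (S : EntropyFunction.{v, u} α) : Prop :=
  ∀ A ∈ 𝒞, ∀ ρ : A.State, ρ.IsRational →
    S A ρ = sSup {s | ∃ (n : ℕ) (Ω : (A.pow n).State) (N : ℕ), ρ.IsCommonDenominator (n + 1) ∧
      Ω.IsQLB N ∧ (∀ k, Ω.IsPartialTrace k ρ) ∧ s = S (A.pow n) Ω / ((n + 1 : ℕ) : ℝ≥0∞)}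

/-- F) Semicontinuity: `S` is lower semicontinuous in trace norm, and `S ρ` is the infimum of the
limits of `S (σ n)` over the sequences `σ n → ρ` of states with finite rank and rational spectrum
(the states for which the preceding axioms already define the entropy). -/
def Semicontinuity (𝒞 : Set (QSystem.{v, u} α)) (S : EntropyFunction.{v, u} α) : Prop :=
  (∀ A ∈ 𝒞, ∀ ρ : A.State, ∀ c < S A ρ, ∃ δ > 0, ∀ σ : A.State,
    traceNorm (σ.op - ρ.op) < δ → c < S A σ) ∧
  ∀ A ∈ 𝒞, ∀ ρ : A.State,
    S A ρ = sInf {s | ∃ σ : ℕ → A.State, (∀ n, (σ n).IsRational) ∧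
      Tendsto (fun n => traceNorm ((σ n).op - ρ.op)) atTop (𝓝 0) ∧
      Tendsto (fun n => S A (σ n)) atTop (𝓝 s)}

/-- The axioms A, ..., F on the states of the systems in `𝒞`. -/
structure SatisfiesAxioms (𝒞 : Set (QSystem.{v, u} α)) (S : EntropyFunction.{v, u} α) : Prop where
  decomposition : Decomposition 𝒞 S
  unitaryInvariance : UnitaryInvariance 𝒞 S
  monotonicity : Monotonicity 𝒞 S
  extensivity : Extensivity 𝒞 S
  rationalCombinatorics : RationalCombinatorics 𝒞 S
  semicontinuity : Semicontinuity 𝒞 S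

end EntropyFunction

/-! Uniqueness rests on a squeeze. A sector of infinite dimension carries a state π(N) for every N,
so monotonicity makes S finite on all QLB states. The n-th tensor power of a π(N) is a π(N ^ n);
hence extensivity and monotonicity turn N ^ n < M ^ m into n S(π(N)) < m S(π(M)). Comparison with N
= 2 through rationals leaves only S(π(N)) = k ln N with k = S(π(2)) / ln 2 (`exists_const_isQLB`).
Rational combinatorics expresses S on rational states through its values on QLB states, and
semicontinuity expresses it on all states through its values on rational ones. Uniqueness thus
reduces to the fact that von Neumann's entropy obeys the same two formulas, which is also the main
part of the converse.

For the combinatorial formula, let p be the eigenvalues of ρ. The diagonal of an admissible QLB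
state Ω of rank N in the product eigenbasis is a distribution on words, bounded by 1/N, with all
one-letter marginals equal to p; Gibbs' inequality gives ln N ≤ n H(p)
(`log_le_sum_negMulLog_of_marginals`). Conversely, take all words in which each letter i occurs
exactly n p i times. Rearranging a word does not change its total charge, so these product vectors
span a subspace of one sector, the uniform state on it has marginals ρ, and Stirling's bounds make
the logarithm of its dimension n H(p) - O(ln n) (`exists_wordOrbit`).

For semicontinuity, the entropy is a supremum of finite diagonal sums, each continuous in operator
norm and so in trace norm. Rational states near ρ with hardly more entropy arise from truncating and
rounding down the eigenvalues, the missing mass going to a single eigenvector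
(`exists_rational_approximation`).

All of this is computed in an eigenbasis adapted to the sectors (`State.exists_eigenbasis`). It
exists because a density matrix is the square of a Hilbert–Schmidt operator and therefore compact.
-/

section HilbertSchmidt

/-! ### Hilbert–Schmidt sums, traces and functional calculus -/

variable {H : Type*} [NormedAddCommGroup H] [InnerProductSpace ℂ H]
  {ι κ : Type*}

theorem HilbertBasis.hasSum_norm_inner_sq (b : HilbertBasis ι ℂ H) (x : H) :
    HasSum (fun i => ‖⟪b i, x⟫_ℂ‖ ^ 2) (‖x‖ ^ 2) := by
  have h := (b.hasSum_inner_mul_inner x x).mapL Complex.reCLM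
  have h1 : Complex.reCLM ⟪x, x⟫_ℂ = ‖x‖ ^ 2 := by
    simpa using inner_self_eq_norm_sq (𝕜 := ℂ) x
  rw [h1] at h
  convert h using 2 with i
  rw [← inner_conj_symm x (b i), RCLike.conj_mul]
  simp [← Complex.ofReal_pow]

theorem HilbertBasis.tsum_ofReal_norm_inner_sq (b : HilbertBasis ι ℂ H) (x : H) :
    ∑' i, ENNReal.ofReal (‖⟪b i, x⟫_ℂ‖ ^ 2) = ENNReal.ofReal (‖x‖ ^ 2) := by
  have h := b.hasSum_norm_inner_sq x
  rw [← h.tsum_eq, ENNReal.ofReal_tsum_of_nonneg (fun i => by positivity) h.summable]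

variable [CompleteSpace H]

/-- By Parseval both sides are the double sum of |⟨c j, T (b i)⟩|². As the two bases are
independent, this yields the basis independence of the trace. -/
theorem HilbertBasis.tsum_ofReal_norm_adjoint_sq (b : HilbertBasis ι ℂ H)
    (c : HilbertBasis κ ℂ H) (T : H →L[ℂ] H) :
    ∑' j, ENNReal.ofReal (‖ContinuousLinearMap.adjoint T (c j)‖ ^ 2) =
      ∑' i, ENNReal.ofReal (‖T (b i)‖ ^ 2) := by
  simp_rw [← b.tsum_ofReal_norm_inner_sq (ContinuousLinearMap.adjoint T _),
    ← c.tsum_ofReal_norm_inner_sq (T _)]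
  rw [ENNReal.tsum_comm]
  refine tsum_congr fun i => tsum_congr fun j => ?_
  rw [ContinuousLinearMap.adjoint_inner_right, ← inner_conj_symm, RCLike.norm_conj]

theorem HilbertBasis.ofReal_norm_apply_sq_le (b : HilbertBasis ι ℂ H) (T : H →L[ℂ] H) (x : H) :
    ENNReal.ofReal (‖T x‖ ^ 2) ≤
      (∑' i, ENNReal.ofReal (‖T (b i)‖ ^ 2)) * ENNReal.ofReal (‖x‖ ^ 2) := by
  rw [← b.tsum_ofReal_norm_inner_sq (T x), ← b.tsum_ofReal_norm_adjoint_sq b T,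
    ← ENNReal.tsum_mul_right]
  refine ENNReal.tsum_le_tsum fun i => ?_
  rw [← ENNReal.ofReal_mul (by positivity), ← ContinuousLinearMap.adjoint_inner_left, ← mul_pow]
  gcongr
  exact norm_inner_le_norm _ _

theorem HilbertBasis.ofReal_opNorm_sq_le (b : HilbertBasis ι ℂ H) (T : H →L[ℂ] H) :
    ENNReal.ofReal (‖T‖ ^ 2) ≤ ∑' i, ENNReal.ofReal (‖T (b i)‖ ^ 2) := by
  by_cases htop : ∑' i, ENNReal.ofReal (‖T (b i)‖ ^ 2) = ⊤
  · exact htop ▸ le_top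
  rw [← ENNReal.ofReal_toReal htop]
  refine ENNReal.ofReal_le_ofReal ?_
  rw [← Real.le_sqrt (norm_nonneg _) ENNReal.toReal_nonneg]
  refine T.opNorm_le_bound (Real.sqrt_nonneg _) fun x => ?_
  have h := b.ofReal_norm_apply_sq_le T x
  rw [← ENNReal.ofReal_toReal htop, ← ENNReal.ofReal_mul ENNReal.toReal_nonneg,
    ENNReal.ofReal_le_ofReal_iff (by positivity)] at h
  refine le_of_sq_le_sq ?_ (by positivity)
  rwa [mul_pow, Real.sq_sqrt ENNReal.toReal_nonneg]

/-- The truncations `R F` have finite rank, and the operator norm of `R F - T` is at most its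
Hilbert–Schmidt norm, whose square is a tail of a convergent sum. -/
theorem HilbertBasis.isCompactOperator_of_tsum_ne_top (b : HilbertBasis ι ℂ H) (T : H →L[ℂ] H)
    (hT : ∑' i, ENNReal.ofReal (‖T (b i)‖ ^ 2) ≠ ⊤) : IsCompactOperator T := by
  classical
  let R : Finset ι → H →L[ℂ] H := fun F =>
    ∑ i ∈ F, InnerProductSpace.rankOne ℂ (T (b i)) (b i)
  have hR : ∀ F i, (R F - T) (b i) = if i ∈ F then 0 else - T (b i) := by
    intro F i
    have := orthonormal_iff_ite.1 b.orthonormal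
    simp only [R, sub_apply, sum_apply,
      InnerProductSpace.rankOne_apply, this, ite_smul, one_smul, zero_smul, Finset.sum_ite_eq']
    split_ifs <;> simp
  have hnorm : ∀ F, ENNReal.ofReal (‖R F - T‖ ^ 2) ≤
      ∑' i : {i // i ∉ F}, ENNReal.ofReal (‖T (b i)‖ ^ 2) := by
    intro F
    refine (b.ofReal_opNorm_sq_le _).trans_eq ?_
    rw [show (∑' i : {i // i ∉ F}, ENNReal.ofReal (‖T (b i)‖ ^ 2)) =
      ∑' i : ({i | i ∉ F} : Set ι), ENNReal.ofReal (‖T (b i)‖ ^ 2) from rfl,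
      tsum_subtype {i | i ∉ F} (fun i => ENNReal.ofReal (‖T (b i)‖ ^ 2))]
    refine tsum_congr fun i => ?_
    rw [hR]
    by_cases hi : i ∈ F <;> simp [hi, Set.indicator]
  have hlim : Tendsto (fun F => ENNReal.ofReal (‖R F - T‖ ^ 2)) atTop (𝓝 0) :=
    tendsto_of_tendsto_of_tendsto_of_le_of_le tendsto_const_nhds
      (ENNReal.tendsto_tsum_compl_atTop_zero hT) (fun _ => zero_le) hnorm
  have hlim' : Tendsto R atTop (𝓝 T) := by
    rw [tendsto_iff_norm_sub_tendsto_zero]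
    have h2 := (ENNReal.tendsto_toReal ENNReal.zero_ne_top).comp hlim
    have h3 := (Real.continuous_sqrt.tendsto _).comp h2
    simpa [Function.comp_def, Real.sqrt_sq] using h3
  refine isCompactOperator_of_tendsto hlim' (Eventually.of_forall fun F => ?_)
  have : R F ∈ compactOperator (RingHom.id ℂ) H H := by
    refine Submodule.sum_mem _ fun i _ => ?_
    change IsCompactOperator (InnerProductSpace.rankOne ℂ (T (b i)) (b i))
    rw [InnerProductSpace.rankOne_def']
    exact (isCompactOperator_of_locallyCompactSpace_rng
      (ContinuousLinearMap.toSpanSingleton ℂ (T (b i)))).comp_clm _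
  exact this

/-- Makes the trace of a positive operator the squared Hilbert–Schmidt norm of its square root, so
that the preceding lemmas apply to traces. -/
theorem ContinuousLinearMap.IsPositive.exists_sqrt {T : H →L[ℂ] H} (hT : T.IsPositive) :
    ∃ S : H →L[ℂ] H, IsSelfAdjoint S ∧ S * S = T ∧
      ∀ x, RCLike.re ⟪x, T x⟫_ℂ = ‖S x‖ ^ 2 := by
  have h0 : 0 ≤ T := (ContinuousLinearMap.nonneg_iff_isPositive T).2 hT
  have hS : IsSelfAdjoint (CFC.sqrt T) := (CFC.sqrt_nonneg T).isSelfAdjoint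
  have hSS : CFC.sqrt T * CFC.sqrt T = T := CFC.sqrt_mul_sqrt_self T h0
  refine ⟨CFC.sqrt T, hS, hSS, fun x => ?_⟩
  conv_lhs => rw [← hSS]
  rw [mul_apply_eq_comp, ← ContinuousLinearMap.adjoint_inner_left,
    ← ContinuousLinearMap.star_eq_adjoint, hS.star_eq]
  exact inner_self_eq_norm_sq _

theorem posTrace_eq_tsum {T : H →L[ℂ] H} (hT : T.IsPositive) (b : HilbertBasis ι ℂ H) :
    posTrace T = ∑' i, ENNReal.ofReal (RCLike.re ⟪b i, T (b i)⟫_ℂ) := by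
  obtain ⟨S, hS, -, hn⟩ := hT.exists_sqrt
  have h := b.tsum_ofReal_norm_adjoint_sq (stdHilbertBasis H) S
  rw [← ContinuousLinearMap.star_eq_adjoint, hS.star_eq] at h
  simp only [posTrace, hn]
  exact h

theorem ofReal_opNorm_le_posTrace {T : H →L[ℂ] H} (hT : T.IsPositive) :
    ENNReal.ofReal ‖T‖ ≤ posTrace T := by
  obtain ⟨S, hS, hSS, hn⟩ := hT.exists_sqrt
  simp only [posTrace, hn]
  refine le_trans ?_ ((stdHilbertBasis H).ofReal_opNorm_sq_le S)
  rw [← hSS, sq]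
  exact ENNReal.ofReal_le_ofReal (norm_mul_le _ _)

theorem ofReal_opNorm_le_traceNorm (T : H →L[ℂ] H) : ENNReal.ofReal ‖T‖ ≤ traceNorm T := by
  have h := ofReal_opNorm_le_posTrace
    ((ContinuousLinearMap.nonneg_iff_isPositive _).1 (CFC.abs_nonneg T))
  rwa [CFC.norm_abs] at h

theorem isCompactOperator_of_posTrace_ne_top {T : H →L[ℂ] H} (hT : T.IsPositive)
    (h : posTrace T ≠ ⊤) : IsCompactOperator T := by
  obtain ⟨S, hS, hSS, hn⟩ := hT.exists_sqrt
  simp only [posTrace, hn] at h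
  have := (stdHilbertBasis H).isCompactOperator_of_tsum_ne_top S h
  rw [← hSS]
  exact this.comp_clm S

theorem opTrace_rankOne_mul (x y : H) (Y : H →L[ℂ] H) :
    HasSum (fun i => ⟪stdHilbertBasis H i,
      (InnerProductSpace.rankOne ℂ x y * Y) (stdHilbertBasis H i)⟫_ℂ) ⟪y, Y x⟫_ℂ := by
  have h := (stdHilbertBasis H).hasSum_inner_mul_inner (ContinuousLinearMap.adjoint Y y) x
  rw [ContinuousLinearMap.adjoint_inner_left] at h
  refine (congrArg (HasSum · _) (funext fun i => ?_)).mpr h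
  rw [mul_apply_eq_comp, InnerProductSpace.rankOne_apply, inner_smul_right,
    ContinuousLinearMap.adjoint_inner_left]

theorem opTrace_sum_smul_rankOne_mul (s : Finset κ) (c : κ → ℂ) (f g : κ → H) (Y : H →L[ℂ] H) :
    opTrace ((∑ j ∈ s, c j • InnerProductSpace.rankOne ℂ (f j) (g j)) * Y) =
      ∑ j ∈ s, c j * ⟪g j, Y (f j)⟫_ℂ := by
  have h := hasSum_sum fun j (_ : j ∈ s) => (opTrace_rankOne_mul (f j) (g j) Y).mul_left (c j)
  rw [opTrace, ← h.tsum_eq]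
  refine tsum_congr fun i => ?_
  simp only [Finset.sum_mul, sum_apply, inner_sum, smul_mul_assoc, smul_apply, inner_smul_right]

/-- The functions on the spectrum for which the claim holds form a closed subalgebra containing the
identity function; Stone–Weierstrass does the rest. -/
theorem cfc_apply_eq_smul {T : H →L[ℂ] H} (hT : IsSelfAdjoint T) {f : ℝ → ℝ} (hf : Continuous f)
    {x : H} {μ : ℝ} (hx : T x = (μ : ℂ) • x) : cfc f T x = (f μ : ℂ) • x := by
  by_cases hx0 : x = 0
  · simp [hx0]
  have hμ : μ ∈ spectrum ℝ T := by
    rw [spectrum.mem_iff]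
    intro hu
    refine hx0 ?_
    obtain ⟨u, hu⟩ := hu
    have h1 : (u : H →L[ℂ] H) x = 0 := by
      rw [hu, sub_apply, hx, Algebra.algebraMap_eq_smul_one]
      simp
    have h2 : ((↑u⁻¹ : H →L[ℂ] H) * u) x = x := by rw [Units.inv_mul]; rfl
    rw [← h2, mul_apply_eq_comp, h1, map_zero]
  rw [cfc_apply f T hT hf.continuousOn]
  have hcont : Continuous (cfcHom (R := ℝ) hT) := cfcHom_continuous hT
  suffices h : ∀ g : C(spectrum ℝ T, ℝ), cfcHom (R := ℝ) hT g x = (g ⟨μ, hμ⟩ : ℂ) • x from h _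
  intro g
  induction g using ContinuousMap.induction_on_of_compact with
  | const r =>
    have : ContinuousMap.const (spectrum ℝ T) r = algebraMap ℝ _ r := rfl
    rw [this, AlgHomClass.commutes, Algebra.algebraMap_eq_smul_one]
    simp [Algebra.algebraMap_eq_smul_one]
  | id => rw [cfcHom_id hT, hx]; rfl
  | star_id => rw [star_trivial, cfcHom_id hT, hx]; rfl
  | add f g hf hg => simp [map_add, hf, hg, add_smul]
  | mul f g hf hg => 
    rw [map_mul, mul_apply_eq_comp, hg, map_smul, hf, smul_smul, mul_comm]
    simp
  | frequently f h =>
    have hc : IsClosed {g : C(spectrum ℝ T, ℝ) | cfcHom (R := ℝ) hT g x = (g ⟨μ, hμ⟩ : ℂ) • x} := by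
      refine isClosed_eq ?_ ?_
      · exact (ContinuousLinearMap.apply ℂ H x).continuous.comp hcont
      · exact (Complex.continuous_ofReal.comp (continuous_eval_const _)).smul
          continuous_const
    exact hc.mem_of_frequently_of_tendsto h tendsto_id

theorem cfcAbs_apply_eq_smul {T : H →L[ℂ] H} (hT : IsSelfAdjoint T)
    {x : H} {μ : ℝ} (hx : T x = (μ : ℂ) • x) : CFC.abs T x = ((|μ| : ℝ) : ℂ) • x := by
  rw [CFC.abs_eq_cfc_norm T hT]
  exact cfc_apply_eq_smul hT continuous_norm hx

end HilbertSchmidt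

/-! ### Diagonalising density matrices inside the sectors -/

namespace QSystem

variable {α : Type v} {A : QSystem.{v, u} α} {ι κ : Type*}

theorem State.isSelfAdjoint (ρ : A.State) : IsSelfAdjoint ρ.op := ρ.isPositive.isSelfAdjoint

theorem State.isCompactOperator (ρ : A.State) : IsCompactOperator ρ.op :=
  isCompactOperator_of_posTrace_ne_top ρ.isPositive (by simp [ρ.trace_eq_one])

theorem State.norm_op_le_one (ρ : A.State) : ‖ρ.op‖ ≤ 1 := by
  have h := ofReal_opNorm_le_posTrace ρ.isPositive
  rwa [ρ.trace_eq_one, ENNReal.ofReal_le_one] at h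

theorem State.spectrum_subset (ρ : A.State) : spectrum ℝ ρ.op ⊆ Set.Icc 0 1 := by
  intro x hx
  have h0 : 0 ≤ ρ.op := (ContinuousLinearMap.nonneg_iff_isPositive _).2 ρ.isPositive
  refine ⟨spectrum_nonneg_of_nonneg h0 hx, ?_⟩
  have hnt : Nontrivial (A.H →L[ℂ] A.H) := by
    by_contra hn
    rw [not_nontrivial_iff_subsingleton] at hn
    rw [spectrum.of_subsingleton] at hx
    exact hx
  have := spectrum.norm_le_norm_of_mem hx
  exact (le_abs_self x).trans (this.trans ρ.norm_op_le_one)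

theorem orthogonalFamily_eigenspace_inf_sector {T : A.H →L[ℂ] A.H} (hT : IsSelfAdjoint T) :
    OrthogonalFamily ℂ
      (fun i : ℂ × (α → ℝ) =>
        (Module.End.eigenspace T.toLinearMap i.1 ⊓ A.sector i.2 : Submodule ℂ A.H))
      fun i => (Module.End.eigenspace T.toLinearMap i.1 ⊓ A.sector i.2).subtypeₗᵢ := by
  refine OrthogonalFamily.of_pairwise fun i j hij => ?_
  refine Submodule.isOrtho_iff_inner_eq.2 fun x hx y hy => ?_
  by_cases h2 : i.2 = j.2
  · have h1 : i.1 ≠ j.1 := fun h1 => hij (Prod.ext h1 h2)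
    exact (ContinuousLinearMap.isSelfAdjoint_iff_isSymmetric.1 hT).orthogonalFamily_eigenspaces h1
      ⟨x, hx.1⟩ ⟨y, hy.1⟩
  · exact Submodule.isOrtho_iff_inner_eq.1 (A.isOrtho_sector _ _ h2) x hx.2 y hy.2

theorem eq_zero_of_forall_orthogonal_sector {x : A.H} (h : ∀ q, ∀ y ∈ A.sector q, ⟪y, x⟫_ℂ = 0) :
    x = 0 := by
  have h1 : (⨆ q, A.sector q)ᗮ = ⊥ := by
    rw [← Submodule.orthogonal_eq_top_iff, Submodule.orthogonal_orthogonal_eq_closure,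
      A.dense_sector]
  have h2 : x ∈ (⨆ q, A.sector q)ᗮ := by
    rw [← Submodule.iInf_orthogonal, Submodule.mem_iInf]
    exact fun q => (Submodule.mem_orthogonal _ _).2 (h q)
  rwa [h1, Submodule.mem_bot] at h2

/-- Being self-adjoint, `T` also preserves the orthogonal complement of a sector, so it commutes
with the projection `P` onto it. Hence `P` maps eigenvectors to eigenvectors in the sector, and `P
x` is orthogonal to every eigenspace. The spectral theorem for compact operators gives `P x = 0` for
each sector. -/
theorem PreservesSectors.eq_zero_of_forall_orthogonal {T : A.H →L[ℂ] A.H}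
    (hA : A.PreservesSectors T) (hT : IsSelfAdjoint T) (hc : IsCompactOperator T) {x : A.H}
    (h : ∀ i : ℂ × (α → ℝ), ∀ y ∈ Module.End.eigenspace T.toLinearMap i.1 ⊓ A.sector i.2,
      ⟪y, x⟫_ℂ = 0) : x = 0 := by
  have hs := ContinuousLinearMap.isSelfAdjoint_iff_isSymmetric.1 hT
  refine eq_zero_of_forall_orthogonal_sector fun q y hy => ?_
  have : CompleteSpace (A.sector q) := (A.isClosed_sector q).completeSpace_coe
  set P := (A.sector q).starProjection with hP
  have hcomm : ∀ z, T (P z) = P (T z) := by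
    intro z
    have hz : z = P z + (z - P z) := by abel
    have h1 : T (P z) ∈ A.sector q := hA q _ (Submodule.starProjection_apply_mem _ _)
    have h2 : T (z - P z) ∈ (A.sector q)ᗮ := by
      rw [Submodule.mem_orthogonal]
      intro w hw
      have := hs w (z - P z)
      simp only [ContinuousLinearMap.coe_coe] at this
      rw [← this]
      exact (Submodule.mem_orthogonal _ _).1 (Submodule.sub_starProjection_mem_orthogonal z) _
        (hA q w hw)
    conv_rhs => rw [hz, map_add, map_add]
    rw [hP, Submodule.starProjection_eq_self_iff.2 h1,
      (Submodule.starProjection_apply_eq_zero_iff _).2 h2, add_zero]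
  have hPx : P x = 0 := by
    have hmem : P x ∈ (⨆ μ, Module.End.eigenspace T.toLinearMap μ)ᗮ := by
      rw [← Submodule.iInf_orthogonal, Submodule.mem_iInf]
      intro μ
      rw [Submodule.mem_orthogonal]
      intro w hw
      rw [← Submodule.inner_starProjection_left_eq_right]
      refine h (μ, q) _ ⟨?_, Submodule.starProjection_apply_mem _ _⟩
      have hw' : T w = μ • w := Module.End.mem_eigenspace_iff.1 hw
      refine Module.End.mem_eigenspace_iff.2 ?_
      change T (P w) = μ • P w
      rw [hcomm, hw', map_smul]
    rwa [ContinuousLinearMap.orthogonalComplement_iSup_eigenspaces_eq_bot hc hs,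
      Submodule.mem_bot] at hmem
  rw [← Submodule.starProjection_eq_self_iff.2 hy, Submodule.inner_starProjection_left_eq_right,
    ← hP, hPx, inner_zero_right]

/-- A density matrix has an orthonormal basis of eigenvectors each of which lies in a sector. -/
theorem State.exists_eigenbasis (ρ : A.State) :
    ∃ (ι : Type (max u v)) (b : HilbertBasis ι ℂ A.H) (p : ι → ℝ) (q : ι → α → ℝ),
      (∀ i, ρ.op (b i) = (p i : ℂ) • b i) ∧ ∀ i, b i ∈ A.sector (q i) := by
  -- All pairs of a number and a charge are admitted; the pairs with zero intersection contribute no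
  -- basis vectors.
  let E : ℂ × (α → ℝ) → Submodule ℂ A.H := fun i =>
    Module.End.eigenspace ρ.op.toLinearMap i.1 ⊓ A.sector i.2
  have hE : ∀ i, IsClosed (E i : Set A.H) := by
    intro i
    refine IsClosed.inter ?_ (A.isClosed_sector i.2)
    have : (Module.End.eigenspace ρ.op.toLinearMap i.1 : Set A.H) =
        {x | ρ.op x = i.1 • x} := by
      ext x
      simp
    rw [this]
    exact isClosed_eq ρ.op.continuous (continuous_const_smul _)
  have : ∀ i, CompleteSpace (E i) := fun i => (hE i).completeSpace_coe
  let f : (Σ i, stdHilbertIndex (E i)) → A.H := fun a => (stdHilbertBasis (E a.1) a.2 : A.H)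
  have hf : Orthonormal ℂ f :=
    (orthogonalFamily_eigenspace_inf_sector ρ.isSelfAdjoint).orthonormal_sigma_orthonormal
      (fun i => (stdHilbertBasis (E i)).orthonormal)
  have hperp : (Submodule.span ℂ (Set.range f))ᗮ = ⊥ := by
    rw [Submodule.eq_bot_iff]
    intro x hx
    refine ρ.preservesSectors.eq_zero_of_forall_orthogonal ρ.isSelfAdjoint ρ.isCompactOperator
      fun i y hy => ?_
    have h1 := (stdHilbertBasis (E i)).hasSum_orthogonalProjectionOnto x
    have h2 : ∀ j, ⟪(stdHilbertBasis (E i) j : A.H), x⟫_ℂ = 0 := fun j =>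
      (Submodule.mem_orthogonal _ _).1 hx _ (Submodule.subset_span ⟨⟨i, j⟩, rfl⟩)
    simp only [h2, zero_smul] at h1
    have h3 := h1.unique hasSum_zero
    have h4 : (E i).starProjection x = 0 := by
      rw [Submodule.starProjection_apply, h3]
      rfl
    have hy' : y ∈ E i := hy
    rw [← Submodule.starProjection_eq_self_iff.2 hy',
      Submodule.inner_starProjection_left_eq_right, h4, inner_zero_right]
  refine ⟨_, HilbertBasis.mkOfOrthogonalEqBot hf hperp, fun a => a.1.1.re, fun a => a.1.2, ?_, ?_⟩
  · intro a
    rw [HilbertBasis.coe_mkOfOrthogonalEqBot]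
    have hmem : f a ∈ Module.End.eigenspace ρ.op.toLinearMap a.1.1 :=
      (stdHilbertBasis (E a.1) a.2).2.1
    have hev : Module.End.HasEigenvalue ρ.op.toLinearMap a.1.1 :=
      Module.End.hasEigenvalue_of_hasEigenvector ⟨hmem, hf.ne_zero a⟩
    have hreal := (ContinuousLinearMap.isSelfAdjoint_iff_isSymmetric.1
      ρ.isSelfAdjoint).conj_eigenvalue_eq_self hev
    rw [Complex.conj_eq_iff_re.1 hreal]
    exact Module.End.mem_eigenspace_iff.1 hmem
  · intro a
    rw [HilbertBasis.coe_mkOfOrthogonalEqBot]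
    exact (stdHilbertBasis (E a.1) a.2).2.2

/-! ### Von Neumann entropy in an eigenbasis -/

section Diagonal

variable {ρ : A.State} {b : HilbertBasis ι ℂ A.H} {p : ι → ℝ}

theorem State.re_inner_of_diagonal (hp : ∀ i, ρ.op (b i) = (p i : ℂ) • b i) (i : ι) :
    RCLike.re ⟪b i, ρ.op (b i)⟫_ℂ = p i := by
  rw [hp, inner_smul_right, inner_self_eq_norm_sq_to_K, b.orthonormal.1 i]
  simp

theorem State.nonneg_of_diagonal (hp : ∀ i, ρ.op (b i) = (p i : ℂ) • b i) (i : ι) : 0 ≤ p i := by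
  rw [← ρ.re_inner_of_diagonal hp i]
  exact ρ.isPositive.re_inner_nonneg_right _

theorem State.tsum_of_diagonal (hp : ∀ i, ρ.op (b i) = (p i : ℂ) • b i) :
    ∑' i, ENNReal.ofReal (p i) = 1 := by
  rw [← ρ.trace_eq_one, posTrace_eq_tsum ρ.isPositive b]
  simp_rw [ρ.re_inner_of_diagonal hp]

theorem State.hasSum_of_diagonal (hp : ∀ i, ρ.op (b i) = (p i : ℂ) • b i) : HasSum p 1 := by
  have h := ρ.tsum_of_diagonal hp
  have h1 := ENNReal.hasSum_toReal (f := fun i => ENNReal.ofReal (p i)) (by rw [h]; simp)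
  rw [← ENNReal.tsum_toReal_eq (fun i => ENNReal.ofReal_ne_top), h] at h1
  simpa [ENNReal.toReal_ofReal (ρ.nonneg_of_diagonal hp _)] using h1

theorem State.le_one_of_diagonal (hp : ∀ i, ρ.op (b i) = (p i : ℂ) • b i) (i : ι) : p i ≤ 1 :=
  le_hasSum (ρ.hasSum_of_diagonal hp) i fun j _ => ρ.nonneg_of_diagonal hp j

theorem State.negMulLog_nonneg_of_diagonal (hp : ∀ i, ρ.op (b i) = (p i : ℂ) • b i) (i : ι) :
    0 ≤ (p i).negMulLog :=
  Real.negMulLog_nonneg (ρ.nonneg_of_diagonal hp i) (ρ.le_one_of_diagonal hp i)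

theorem State.isPositive_cfc_negMulLog (ρ : A.State) :
    (cfc Real.negMulLog ρ.op).IsPositive := by
  rw [← ContinuousLinearMap.nonneg_iff_isPositive]
  refine cfc_nonneg fun x hx => ?_
  have := ρ.spectrum_subset hx
  exact Real.negMulLog_nonneg this.1 this.2

theorem State.vonNeumannEntropy_eq_tsum_inner (k : ℝ) (ρ : A.State) (b : HilbertBasis ι ℂ A.H) :
    ρ.vonNeumannEntropy k = ENNReal.ofReal k *
      ∑' i, ENNReal.ofReal (RCLike.re ⟪b i, cfc Real.negMulLog ρ.op (b i)⟫_ℂ) := by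
  rw [State.vonNeumannEntropy, ← Real.negMulLog_eq_neg,
    posTrace_eq_tsum ρ.isPositive_cfc_negMulLog b]

theorem State.re_inner_cfc_of_diagonal (hp : ∀ i, ρ.op (b i) = (p i : ℂ) • b i) (i : ι) :
    RCLike.re ⟪b i, cfc Real.negMulLog ρ.op (b i)⟫_ℂ = (p i).negMulLog := by
  rw [cfc_apply_eq_smul ρ.isSelfAdjoint Real.continuous_negMulLog (hp i), inner_smul_right,
    inner_self_eq_norm_sq_to_K, b.orthonormal.1 i]
  simp

theorem State.vonNeumannEntropy_eq_tsum (k : ℝ) (hp : ∀ i, ρ.op (b i) = (p i : ℂ) • b i) :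
    ρ.vonNeumannEntropy k =
      ENNReal.ofReal k * ∑' i, ENNReal.ofReal (p i).negMulLog := by
  rw [ρ.vonNeumannEntropy_eq_tsum_inner k b]
  simp_rw [ρ.re_inner_cfc_of_diagonal hp]

end Diagonal

/-- The relation forces every eigenvalue to be 0 or `c`. It covers QLB states (`c = 1 / N`) and pure
states (`c = 1`) together. -/
theorem State.vonNeumannEntropy_of_mul_self (k : ℝ) {ρ : A.State} {c : ℝ}
    (h : ρ.op * ρ.op = (c : ℂ) • ρ.op) :
    ρ.vonNeumannEntropy k = ENNReal.ofReal k * ENNReal.ofReal (-Real.log c) := by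
  obtain ⟨ι, b, p, -, hp, -⟩ := ρ.exists_eigenbasis
  rw [ρ.vonNeumannEntropy_eq_tsum k hp]
  congr 1
  have hpc : ∀ i, (p i).negMulLog = p i * -Real.log c := by
    intro i
    have h1 := congrArg (fun T : A.H →L[ℂ] A.H => T (b i)) h
    simp only [mul_apply_eq_comp, smul_apply, hp, map_smul, smul_smul] at h1
    have h2 := smul_left_injective ℂ (b.orthonormal.ne_zero i) h1
    have h3 : p i * p i = c * p i := by exact_mod_cast h2
    rcases eq_or_ne (p i) 0 with h0 | h0
    · simp [h0]
    · rw [mul_right_cancel₀ h0 h3, Real.negMulLog]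
      ring
  simp_rw [hpc, fun i => ENNReal.ofReal_mul (q := -Real.log c) (ρ.nonneg_of_diagonal hp i)]
  rw [ENNReal.tsum_mul_right, ρ.tsum_of_diagonal hp, one_mul]

/-! ### States with prescribed eigenvectors; QLB states -/

theorem posTrace_eq_of_hasSum {H : Type*} [NormedAddCommGroup H] [InnerProductSpace ℂ H]
    [CompleteSpace H] {T : H →L[ℂ] H} (hT : T.IsPositive) {t : ℂ}
    (h : HasSum (fun i => ⟪stdHilbertBasis H i, T (stdHilbertBasis H i)⟫_ℂ) t) :
    posTrace T = ENNReal.ofReal t.re := by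
  have h1 : HasSum (fun i => RCLike.re ⟪stdHilbertBasis H i, T (stdHilbertBasis H i)⟫_ℂ) t.re :=
    h.mapL Complex.reCLM
  rw [posTrace, ← h1.tsum_eq,
    ENNReal.ofReal_tsum_of_nonneg (fun i => hT.re_inner_nonneg_right _) h1.summable]

theorem preservesSectors_rankOne {x : A.H} {q : α → ℝ} (hx : x ∈ A.sector q) :
    A.PreservesSectors (InnerProductSpace.rankOne ℂ x x) := by
  intro r y hy
  rw [InnerProductSpace.rankOne_apply]
  by_cases hqr : q = r
  · exact Submodule.smul_mem _ _ (hqr ▸ hx)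
  · rw [Submodule.isOrtho_iff_inner_eq.1 (A.isOrtho_sector _ _ hqr) x hx y hy, zero_smul]
    exact Submodule.zero_mem _

theorem exists_state_of_orthonormal {f : κ → A.H} (hf : Orthonormal ℂ f) {q : κ → α → ℝ}
    (hq : ∀ i, f i ∈ A.sector (q i)) (s : Finset κ) {c : κ → ℝ} (hc : ∀ i ∈ s, 0 ≤ c i)
    (hsum : ∑ i ∈ s, c i = 1) :
    ∃ ρ : A.State, ρ.op = ∑ i ∈ s, (c i : ℂ) • InnerProductSpace.rankOne ℂ (f i) (f i) := by
  have hpos : (∑ i ∈ s, (c i : ℂ) • InnerProductSpace.rankOne ℂ (f i) (f i) :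
      A.H →L[ℂ] A.H).IsPositive := by
    rw [← ContinuousLinearMap.nonneg_iff_isPositive]
    refine Finset.sum_nonneg fun i hi => ?_
    rw [ContinuousLinearMap.nonneg_iff_isPositive]
    exact (InnerProductSpace.isPositive_rankOne_self (f i)).smul_of_nonneg
      (by exact_mod_cast hc i hi)
  refine ⟨⟨_, hpos, ?_, ?_⟩, rfl⟩
  · have h := hasSum_sum fun j (_ : j ∈ s) =>
      (opTrace_rankOne_mul (f j) (f j) 1).mul_left (c j : ℂ)
    have h' := posTrace_eq_of_hasSum hpos (t := ∑ j ∈ s, (c j : ℂ) * ⟪f j, f j⟫_ℂ)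
      ((congrArg (HasSum · _) (funext fun i => ?_)).mpr h)
    · rw [h']
      simp only [inner_self_eq_norm_sq_to_K, hf.1]
      have : (∑ j ∈ s, (c j : ℂ) * ((1 : ℝ) : ℂ) ^ 2) = ((∑ j ∈ s, c j : ℝ) : ℂ) := by
        push_cast
        simp
      rw [hsum] at this
      exact (congrArg (fun z : ℂ => ENNReal.ofReal z.re) this).trans (by simp)
    · simp only [mul_one, sum_apply, inner_sum, smul_apply, inner_smul_right]
  · intro r x hx
    rw [sum_apply]
    exact Submodule.sum_mem _ fun i _ =>
      Submodule.smul_mem _ _ (preservesSectors_rankOne (hq i) r x hx)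

theorem exists_isQLB_of_orthonormal {f : κ → A.H} (hf : Orthonormal ℂ f) {q : α → ℝ}
    (s : Finset κ) (hs : s.Nonempty) (hq : ∀ i ∈ s, f i ∈ A.sector q) :
    ∃ Ω : A.State, Ω.IsQLB s.card ∧
      Ω.op = ∑ i ∈ s, ((s.card : ℂ)⁻¹) • InnerProductSpace.rankOne ℂ (f i) (f i) := by
  classical
  have hcard : (s.card : ℝ) ≠ 0 := by exact_mod_cast hs.card_ne_zero
  -- The family is restricted to `s` because only its members there are known to lie in a sector.
  obtain ⟨Ω, hΩ⟩ := exists_state_of_orthonormal (hf.comp ((↑) : s → κ) Subtype.val_injective)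
    (q := fun _ => q) (fun i => hq i i.2) Finset.univ (c := fun _ => (s.card : ℝ)⁻¹)
    (fun _ _ => by positivity) (by simp [hcard])
  have hop : Ω.op =
      ∑ i ∈ s, ((s.card : ℂ)⁻¹) • InnerProductSpace.rankOne ℂ (f i) (f i) := by
    rw [hΩ, ← Finset.sum_coe_sort s]
    simp
  refine ⟨Ω, ⟨q, Submodule.span ℂ (s.image f : Set A.H), inferInstance, ?_, ?_, ?_⟩, hop⟩
  · rw [Submodule.span_le]
    intro x hx
    obtain ⟨i, hi, rfl⟩ := by simpa using hx
    exact hq i hi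
  · rw [Module.finrank_eq_card_basis (OrthonormalBasis.span hf s).toBasis, Fintype.card_coe]
  · rw [hop, (OrthonormalBasis.span hf s).starProjection_eq_sum_rankOne, ← Finset.sum_coe_sort s,
      Finset.smul_sum]
    simp [OrthonormalBasis.span_apply]

theorem State.IsQLB.exists_orthonormal {Ω : A.State} {N : ℕ} (h : Ω.IsQLB N) :
    ∃ (f : Fin N → A.H) (q : α → ℝ), Orthonormal ℂ f ∧ (∀ i, f i ∈ A.sector q) ∧
      Ω.op = ∑ i, ((N : ℂ)⁻¹) • InnerProductSpace.rankOne ℂ (f i) (f i) := by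
  obtain ⟨q, V, _, hV, rfl, hop⟩ := h
  refine ⟨fun i => (stdOrthonormalBasis ℂ V i : A.H), q, ?_, fun i => hV (Subtype.mem _), ?_⟩
  · exact (stdOrthonormalBasis ℂ V).orthonormal.comp_linearIsometry V.subtypeₗᵢ
  · rw [hop, (stdOrthonormalBasis ℂ V).starProjection_eq_sum_rankOne, Finset.smul_sum]

theorem State.op_ne_zero (ρ : A.State) : ρ.op ≠ 0 := by
  intro h
  have := ρ.trace_eq_one
  simp [h, posTrace] at this

theorem State.IsQLB.pos {Ω : A.State} {N : ℕ} (h : Ω.IsQLB N) : 0 < N := by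
  obtain ⟨f, q, -, -, hop⟩ := h.exists_orthonormal
  rcases N.eq_zero_or_pos with rfl | h0
  · exact absurd (by simpa using hop) Ω.op_ne_zero
  · exact h0

theorem State.IsQLB.vonNeumannEntropy_eq {Ω : A.State} {N : ℕ} (h : Ω.IsQLB N) (k : ℝ) :
    Ω.vonNeumannEntropy k = ENNReal.ofReal k * ENNReal.ofReal (Real.log N) := by
  obtain ⟨q, V, _, hV, -, hop⟩ := h
  rw [Ω.vonNeumannEntropy_of_mul_self k (c := (N : ℝ)⁻¹), Real.log_inv, neg_neg]
  rw [hop, smul_mul_smul_comm, ← smul_smul]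
  have : V.starProjection * V.starProjection = V.starProjection :=
    Submodule.isIdempotentElem_starProjection V
  rw [this]
  simp

theorem State.IsPure.vonNeumannEntropy_eq {ρ : A.State} (h : ρ.IsPure) (k : ℝ) :
    ρ.vonNeumannEntropy k = 0 := by
  obtain ⟨ψ, hψ, hop⟩ := h
  rw [ρ.vonNeumannEntropy_of_mul_self k (c := 1)]
  · simp
  · have : ρ.op * ρ.op = ρ.op := by
      rw [hop]
      exact InnerProductSpace.isIdempotentElem_rankOne_self hψ
    simpa using this

end QSystem

/-! ### Product vectors and bases of compound systems -/

namespace QSystem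

variable {α : Type v} {A B : QSystem.{v, u} α} {ι κ : Type*}

/-- The elementary tensor `x ⊗ y` as a bilinear map into the Hilbert space of the compound. -/
noncomputable def tensorVec (A B : QSystem.{v, u} α) : A.H →ₗ[ℂ] B.H →ₗ[ℂ] (A.tensor B).H :=
  (TensorProduct.mk ℂ A.H B.H).compr₂
    (Completion.toComplL : (A.H ⊗[ℂ] B.H) →L[ℂ] Completion (A.H ⊗[ℂ] B.H)).toLinearMap

theorem inner_tensorVec (x x' : A.H) (y y' : B.H) :
    ⟪tensorVec A B x y, tensorVec A B x' y'⟫_ℂ = ⟪x, x'⟫_ℂ * ⟪y, y'⟫_ℂ :=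
  (Completion.inner_coe _ _).trans (TensorProduct.inner_tmul (𝕜 := ℂ) x x' y y')

theorem norm_tensorVec (x : A.H) (y : B.H) : ‖tensorVec A B x y‖ = ‖x‖ * ‖y‖ :=
  (Completion.norm_coe _).trans (TensorProduct.norm_tmul _ _)

theorem continuous_tensorVec_left (y : B.H) : Continuous fun x : A.H => tensorVec A B x y :=
  (((tensorVec A B).flip y).mkContinuous ‖y‖ fun x => by
    rw [LinearMap.flip_apply, norm_tensorVec, mul_comm]).continuous

theorem continuous_tensorVec_right (x : A.H) : Continuous fun y : B.H => tensorVec A B x y :=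
  ((tensorVec A B x).mkContinuous ‖x‖ fun y => by rw [norm_tensorVec]).continuous

theorem tensorOp_tensorVec (T : A.H →L[ℂ] A.H) (R : B.H →L[ℂ] B.H) (x : A.H) (y : B.H) :
    tensorOp T R (tensorVec A B x y) = tensorVec A B (T x) (R y) :=
  ContinuousLinearMap.completion_apply_coe _ _

theorem tensorVec_mem_sector {x : A.H} {y : B.H} {p q : α → ℝ} (hx : x ∈ A.sector p)
    (hy : y ∈ B.sector q) : tensorVec A B x y ∈ (A.tensor B).sector (p + q) :=
  Submodule.le_topologicalClosure (M := Completion (A.H ⊗[ℂ] B.H)) _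
    (Submodule.subset_span ⟨p, q, rfl, x, hx, y, hy, rfl⟩)

/-- Totality is extended one argument at a time: with the other argument fixed, the vectors whose
product lies in `M` form a closed subspace. -/
theorem closure_span_tensorVec {f : ι → A.H} {g : κ → B.H}
    (hf : (Submodule.span ℂ (Set.range f)).topologicalClosure = ⊤)
    (hg : (Submodule.span ℂ (Set.range g)).topologicalClosure = ⊤)
    {M : Submodule ℂ (A.tensor B).H} (hM : IsClosed (M : Set (A.tensor B).H))
    (h : ∀ i j, tensorVec A B (f i) (g j) ∈ M) : M = ⊤ := by
  have h1 : ∀ i y, tensorVec A B (f i) y ∈ M := by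
    intro i y
    have hle : (Submodule.span ℂ (Set.range g)).topologicalClosure ≤
        M.comap (tensorVec A B (f i)) := by
      refine Submodule.topologicalClosure_minimal _ ?_
        (hM.preimage (continuous_tensorVec_right (f i)))
      rw [Submodule.span_le]
      rintro _ ⟨j, rfl⟩
      exact h i j
    rw [hg] at hle
    exact hle (Submodule.mem_top (x := y))
  have h2 : ∀ x y, tensorVec A B x y ∈ M := by
    intro x y
    have hle : (Submodule.span ℂ (Set.range f)).topologicalClosure ≤
        M.comap ((tensorVec A B).flip y) := by
      refine Submodule.topologicalClosure_minimal _ ?_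
        (hM.preimage (continuous_tensorVec_left y))
      rw [Submodule.span_le]
      rintro _ ⟨i, rfl⟩
      exact h1 i y
    rw [hf] at hle
    exact hle (Submodule.mem_top (x := x))
  have h3 : ∀ z : A.H ⊗[ℂ] B.H, (z : Completion (A.H ⊗[ℂ] B.H)) ∈ M := by
    intro z
    induction z with
    | zero => exact M.zero_mem
    | tmul x y => exact h2 x y
    | add x y hx hy =>
      rw [Completion.coe_add]
      exact M.add_mem hx hy
  refine eq_top_iff.2 fun z _ => ?_
  exact Completion.induction_on (p := fun z => z ∈ (M : Set (A.tensor B).H)) z hM h3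

theorem tensorOp_ext {T R : (A.tensor B).H →L[ℂ] (A.tensor B).H}
    (h : ∀ x y, T (tensorVec A B x y) = R (tensorVec A B x y)) : T = R := by
  have htop : ∀ C : QSystem.{v, u} α,
      (Submodule.span ℂ (Set.range (id : C.H → C.H))).topologicalClosure = ⊤ := by
    intro C
    rw [Set.range_id, Submodule.span_univ]
    exact top_unique (Submodule.le_topologicalClosure _)
  have := closure_span_tensorVec (htop A) (htop B)
    (M := LinearMap.eqLocus T.toLinearMap R.toLinearMap)
    (isClosed_eq T.continuous R.continuous) h
  ext z
  have hz : z ∈ LinearMap.eqLocus T.toLinearMap R.toLinearMap := this ▸ Submodule.mem_top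
  exact hz

theorem tensorOp_sum_rankOne (s : Finset ι) (t : Finset κ) (a : ι → ℂ) (c : κ → ℂ)
    (f : ι → A.H) (g : κ → B.H) :
    tensorOp (∑ i ∈ s, a i • InnerProductSpace.rankOne ℂ (f i) (f i))
      (∑ j ∈ t, c j • InnerProductSpace.rankOne ℂ (g j) (g j)) =
    ∑ x ∈ s ×ˢ t, (a x.1 * c x.2) • InnerProductSpace.rankOne ℂ
      (tensorVec A B (f x.1) (g x.2)) (tensorVec A B (f x.1) (g x.2)) := by
  refine tensorOp_ext fun x y => ?_
  rw [tensorOp_tensorVec, Finset.sum_product]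
  simp only [sum_apply, smul_apply, InnerProductSpace.rankOne_apply, inner_tensorVec, map_sum,
    map_smul, LinearMap.sum_apply, LinearMap.smul_apply, smul_smul, Finset.smul_sum]
  rw [Finset.sum_comm]
  refine Finset.sum_congr rfl fun i _ => Finset.sum_congr rfl fun j _ => ?_
  congr 1
  ring

/-- The product vectors `f i₀ ⊗ ⋯ ⊗ f iₙ`. -/
noncomputable def powVec (f : ι → A.H) : (n : ℕ) → (Fin (n + 1) → ι) → (A.pow n).H
  | 0, I => f (I 0)
  | n + 1, I => tensorVec (A.pow n) A (powVec f n fun k => I k.castSucc) (f (I (Fin.last _)))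

theorem powVec_snoc (f : ι → A.H) (n : ℕ) (I : Fin (n + 1) → ι) (i : ι) :
    powVec f (n + 1) (Fin.snoc (α := fun _ => ι) I i) =
      tensorVec (A.pow n) A (powVec f n I) (f i) := by
  change tensorVec (A.pow n) A
    (powVec f n fun k => (Fin.snoc (α := fun _ => ι) I i : Fin (n + 2) → ι) k.castSucc)
    (f ((Fin.snoc (α := fun _ => ι) I i : Fin (n + 2) → ι) (Fin.last _))) = _
  simp only [Fin.snoc_castSucc, Fin.snoc_last]

theorem siteOp_last (X : A.H →L[ℂ] A.H) (n : ℕ) :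
    siteOp X (n + 1) (Fin.last (n + 1)) = tensorOp (A := A.pow n) (B := A) 1 X :=
  Fin.lastCases_last

theorem siteOp_castSucc (X : A.H →L[ℂ] A.H) (n : ℕ) (j : Fin (n + 1)) :
    siteOp X (n + 1) j.castSucc = tensorOp (A := A.pow n) (B := A) (siteOp X n j) 1 :=
  Fin.lastCases_castSucc j

theorem inner_powVec (f g : ι → A.H) (n : ℕ) (I J : Fin (n + 1) → ι) :
    ⟪powVec f n I, powVec g n J⟫_ℂ = ∏ k, ⟪f (I k), g (J k)⟫_ℂ := by
  induction n with
  | zero => rw [Fin.prod_univ_one]; rfl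
  | succ n ih =>
    rw [Fin.prod_univ_castSucc, ← ih (fun k => I k.castSucc) fun k => J k.castSucc]
    exact inner_tensorVec _ _ _ _

theorem orthonormal_powVec {f : ι → A.H} (hf : Orthonormal ℂ f) (n : ℕ) :
    Orthonormal ℂ (powVec f n) := by
  classical
  rw [orthonormal_iff_ite] at hf ⊢
  intro I J
  rw [inner_powVec]
  simp_rw [hf]
  rw [Finset.prod_ite_zero]
  simp [funext_iff]

theorem powVec_mem_sector {f : ι → A.H} {q : ι → α → ℝ} (hq : ∀ i, f i ∈ A.sector (q i)) (n : ℕ)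
    (I : Fin (n + 1) → ι) : powVec f n I ∈ (A.pow n).sector (∑ k, q (I k)) := by
  induction n with
  | zero => rw [Fin.sum_univ_one]; exact hq (I 0)
  | succ n ih =>
    rw [Fin.sum_univ_castSucc]
    exact tensorVec_mem_sector (ih fun k => I k.castSucc) (hq _)

theorem closure_span_powVec {f : ι → A.H}
    (hf : (Submodule.span ℂ (Set.range f)).topologicalClosure = ⊤) (n : ℕ) :
    (Submodule.span ℂ (Set.range (powVec f n))).topologicalClosure = ⊤ := by
  induction n with
  | zero =>
    have : Set.range (powVec f 0) = (Set.range f : Set A.H) := by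
      ext x
      constructor
      · rintro ⟨I, rfl⟩
        exact ⟨I 0, rfl⟩
      · rintro ⟨i, rfl⟩
        exact ⟨fun _ => i, rfl⟩
    exact (congrArg (fun s : Set A.H => (Submodule.span ℂ s).topologicalClosure) this).trans hf
  | succ n ih =>
    have hcl := Submodule.isClosed_topologicalClosure
      (Submodule.span ℂ (Set.range (powVec f (n + 1))))
    have hmem : ∀ I, powVec f (n + 1) I ∈
        (Submodule.span ℂ (Set.range (powVec f (n + 1)))).topologicalClosure := fun I =>
      Submodule.le_topologicalClosure _ (Submodule.subset_span ⟨_, rfl⟩)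
    exact closure_span_tensorVec (A := A.pow n) (B := A) ih hf hcl
      fun I i => powVec_snoc f n I i ▸ hmem _

/-- The Hilbert basis of product vectors of a compound of two systems. -/
noncomputable def tensorBasis (b : HilbertBasis ι ℂ A.H) (c : HilbertBasis κ ℂ B.H) :
    HilbertBasis (ι × κ) ℂ (A.tensor B).H :=
  HilbertBasis.mk (v := fun x : ι × κ => tensorVec A B (b x.1) (c x.2))
    (by
      classical
      rw [orthonormal_iff_ite]
      intro x y
      rw [inner_tensorVec, orthonormal_iff_ite.1 b.orthonormal, orthonormal_iff_ite.1 c.orthonormal]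
      by_cases h1 : x.1 = y.1 <;> by_cases h2 : x.2 = y.2 <;> simp [Prod.ext_iff, h1, h2])
    (closure_span_tensorVec b.dense_span c.dense_span
      (M := (Submodule.span ℂ (Set.range
        fun x : ι × κ => tensorVec A B (b x.1) (c x.2))).topologicalClosure)
      (Submodule.isClosed_topologicalClosure _)
      fun i j => Submodule.le_topologicalClosure _ (Submodule.subset_span ⟨(i, j), rfl⟩)).ge

theorem tensorBasis_apply (b : HilbertBasis ι ℂ A.H) (c : HilbertBasis κ ℂ B.H) (x : ι × κ) :
    tensorBasis b c x = tensorVec A B (b x.1) (c x.2) := by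
  rw [tensorBasis, HilbertBasis.coe_mk]

/-- The Hilbert basis of product vectors of a compound of copies of a system. -/
noncomputable def powBasis (b : HilbertBasis ι ℂ A.H) (n : ℕ) :
    HilbertBasis (Fin (n + 1) → ι) ℂ (A.pow n).H :=
  HilbertBasis.mk (orthonormal_powVec b.orthonormal n) (closure_span_powVec b.dense_span n).ge

theorem powBasis_apply (b : HilbertBasis ι ℂ A.H) (n : ℕ) (I : Fin (n + 1) → ι) :
    powBasis b n I = powVec b n I := by
  rw [powBasis, HilbertBasis.coe_mk]

theorem powOp_powVec {T : A.H →L[ℂ] A.H} {f : ι → A.H} {c : ι → ℂ}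
    (h : ∀ i, T (f i) = c i • f i) (n : ℕ) (I : Fin (n + 1) → ι) :
    powOp T n (powVec f n I) = (∏ k, c (I k)) • powVec f n I := by
  induction n with
  | zero => rw [Fin.prod_univ_one]; exact h (I 0)
  | succ n ih =>
    rw [Fin.prod_univ_castSucc]
    refine (tensorOp_tensorVec _ _ _ _).trans ?_
    rw [ih, h, LinearMap.map_smul₂, map_smul, smul_smul]
    rfl

theorem powOp_sum_rankOne [Fintype ι] (c : ℂ) (f : ι → A.H) (n : ℕ) :
    powOp (∑ i, c • InnerProductSpace.rankOne ℂ (f i) (f i)) n =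
      ∑ I, (c ^ (n + 1)) • InnerProductSpace.rankOne ℂ (powVec f n I) (powVec f n I) := by
  induction n with
  | zero =>
    rw [← (Equiv.funUnique (Fin 1) ι).symm.sum_comp]
    simp only [zero_add, pow_one]
    rfl
  | succ n ih =>
    rw [← (Fin.snocEquiv fun _ => ι).sum_comp, ← (Equiv.prodComm _ _).sum_comp]
    refine (congrArg (fun T => tensorOp (A := A.pow n) (B := A) T _) ih).trans ?_
    rw [tensorOp_sum_rankOne, Finset.univ_product_univ]
    refine Finset.sum_congr rfl fun x _ => ?_
    have : (Fin.snocEquiv fun _ => ι) ((Equiv.prodComm _ _) x) =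
      Fin.snoc (α := fun _ => ι) x.1 x.2 := rfl
    rw [this, powVec_snoc, pow_succ c (n + 1)]
    rfl

/-- Diagonal elements suffice for the partial traces of operators diagonal in the product vectors,
and for these `X` may be arbitrary: all other factors contribute 1. -/
theorem inner_siteOp_powVec {f : ι → A.H} (hf : Orthonormal ℂ f) (X : A.H →L[ℂ] A.H) (n : ℕ)
    (k : Fin (n + 1)) (I : Fin (n + 1) → ι) :
    ⟪powVec f n I, siteOp X n k (powVec f n I)⟫_ℂ = ⟪f (I k), X (f (I k))⟫_ℂ := by
  induction n with
  | zero => rw [Fin.eq_zero k]; rfl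
  | succ n ih =>
    have h1 : ∀ i, ⟪f i, f i⟫_ℂ = 1 := fun i => by
      rw [inner_self_eq_norm_sq_to_K, hf.1]; simp
    have h2 : ∀ J, ⟪powVec f n J, powVec f n J⟫_ℂ = 1 := fun J => by
      rw [inner_self_eq_norm_sq_to_K, (orthonormal_powVec hf n).1]; simp
    induction k using Fin.lastCases with
    | last =>
      rw [siteOp_last]
      refine (congrArg (inner ℂ _) (tensorOp_tensorVec _ _ _ _)).trans ?_
      refine (inner_tensorVec _ _ _ _).trans ?_
      rw [one_apply_eq_self, h2, one_mul]
    | cast j =>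
      rw [siteOp_castSucc]
      refine (congrArg (inner ℂ _) (tensorOp_tensorVec _ _ _ _)).trans ?_
      refine (inner_tensorVec _ _ _ _).trans ?_
      rw [one_apply_eq_self, h1, mul_one, ih]

theorem siteOp_powVec {f : ι → A.H} {X : A.H →L[ℂ] A.H} {c : ι → ℂ}
    (h : ∀ i, X (f i) = c i • f i) (n : ℕ) (k : Fin (n + 1)) (I : Fin (n + 1) → ι) :
    siteOp X n k (powVec f n I) = c (I k) • powVec f n I := by
  induction n with
  | zero => rw [Fin.eq_zero k]; exact h (I 0)
  | succ n ih =>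
    induction k using Fin.lastCases with
    | last =>
      rw [siteOp_last]
      refine (tensorOp_tensorVec _ _ _ _).trans ?_
      rw [h, map_smul]
      rfl
    | cast j =>
      rw [siteOp_castSucc]
      refine (tensorOp_tensorVec _ _ _ _).trans ?_
      rw [ih, LinearMap.map_smul₂]
      rfl

end QSystem

/-! ### Additivity and unitary invariance -/

theorem tsum_ofReal_negMulLog_mul {ι κ : Type*} {p : ι → ℝ} {r : κ → ℝ} (hp0 : ∀ i, 0 ≤ p i)
    (hp1 : ∀ i, p i ≤ 1) (hr0 : ∀ j, 0 ≤ r j) (hr1 : ∀ j, r j ≤ 1)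
    (hp : ∑' i, ENNReal.ofReal (p i) = 1) (hr : ∑' j, ENNReal.ofReal (r j) = 1) :
    ∑' x : ι × κ, ENNReal.ofReal (p x.1 * r x.2).negMulLog =
      ∑' i, ENNReal.ofReal (p i).negMulLog + ∑' j, ENNReal.ofReal (r j).negMulLog := by
  have hp2 := fun i => Real.negMulLog_nonneg (hp0 i) (hp1 i)
  have hr2 := fun j => Real.negMulLog_nonneg (hr0 j) (hr1 j)
  rw [ENNReal.tsum_prod']
  -- With η(x) = -x ln x one has η(xy) = y η(x) + x η(y). All terms are nonnegative, so the sums may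
  -- be split in `[0, ∞]` even if an entropy is infinite.
  have h : ∀ i j, ENNReal.ofReal (p i * r j).negMulLog =
      ENNReal.ofReal (r j) * ENNReal.ofReal (p i).negMulLog +
        ENNReal.ofReal (p i) * ENNReal.ofReal (r j).negMulLog := by
    intro i j
    rw [Real.negMulLog_mul, ENNReal.ofReal_add (mul_nonneg (hr0 j) (hp2 i))
      (mul_nonneg (hp0 i) (hr2 j)), ENNReal.ofReal_mul (hr0 j), ENNReal.ofReal_mul (hp0 i)]
  simp_rw [h, ENNReal.tsum_add, ENNReal.tsum_mul_right, ENNReal.tsum_mul_left, hr,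
    ENNReal.tsum_mul_right, hp, one_mul]

/-- The normalisation is proved along with the entropy because the additivity used in the induction
step needs it. -/
theorem tsum_ofReal_negMulLog_prod {ι : Type*} {p : ι → ℝ} (hp0 : ∀ i, 0 ≤ p i)
    (hp1 : ∀ i, p i ≤ 1) (hp : ∑' i, ENNReal.ofReal (p i) = 1) (n : ℕ) :
    ∑' I : Fin (n + 1) → ι, ENNReal.ofReal (∏ k, p (I k)) = 1 ∧
    ∑' I : Fin (n + 1) → ι, ENNReal.ofReal (∏ k, p (I k)).negMulLog =
      ((n + 1 : ℕ) : ℝ≥0∞) * ∑' i, ENNReal.ofReal (p i).negMulLog := by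
  induction n with
  | zero =>
    constructor
    · rw [← (Equiv.funUnique (Fin 1) ι).symm.tsum_eq]
      simpa using hp
    · rw [← (Equiv.funUnique (Fin 1) ι).symm.tsum_eq]
      simp
  | succ n ih =>
    have h0 : ∀ I : Fin (n + 1) → ι, 0 ≤ ∏ k, p (I k) := fun I =>
      Finset.prod_nonneg fun k _ => hp0 _
    have h1 : ∀ I : Fin (n + 1) → ι, ∏ k, p (I k) ≤ 1 := fun I =>
      Finset.prod_le_one (fun k _ => hp0 _) fun k _ => hp1 _
    have e : ∀ x : (Fin (n + 1) → ι) × ι,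
        ∏ k, p ((Fin.snocEquiv fun _ => ι) (Equiv.prodComm _ _ x) k) =
          (∏ k, p (x.1 k)) * p x.2 := by
      intro x
      rw [Fin.prod_univ_castSucc]
      simp [Fin.snocEquiv]
    constructor
    · rw [← (Fin.snocEquiv fun _ => ι).tsum_eq, ← (Equiv.prodComm _ _).tsum_eq]
      simp_rw [e, fun x : (Fin (n + 1) → ι) × ι => ENNReal.ofReal_mul (q := p x.2) (h0 x.1)]
      rw [ENNReal.tsum_prod']
      simp_rw [ENNReal.tsum_mul_left, hp, mul_one, ih.1]
    · rw [← (Fin.snocEquiv fun _ => ι).tsum_eq, ← (Equiv.prodComm _ _).tsum_eq]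
      simp_rw [e]
      rw [tsum_ofReal_negMulLog_mul h0 h1 hp0 hp1 ih.1 hp, ih.2]
      push_cast
      ring

namespace QSystem

variable {α : Type v} {A B : QSystem.{v, u} α}

theorem State.vonNeumannEntropy_tensor (k : ℝ) {ρ : A.State} {σ : B.State}
    {τ : (A.tensor B).State} (h : τ.op = tensorOp ρ.op σ.op) :
    τ.vonNeumannEntropy k = ρ.vonNeumannEntropy k + σ.vonNeumannEntropy k := by
  obtain ⟨ι, b, p, -, hp, -⟩ := ρ.exists_eigenbasis
  obtain ⟨κ, c, r, -, hr, -⟩ := σ.exists_eigenbasis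
  have hτ : ∀ x, τ.op (tensorBasis b c x) = ((p x.1 * r x.2 : ℝ) : ℂ) • tensorBasis b c x := by
    intro x
    rw [h, tensorBasis_apply, tensorOp_tensorVec, hp, hr, LinearMap.map_smul₂, map_smul, smul_smul]
    push_cast
    rfl
  rw [τ.vonNeumannEntropy_eq_tsum k hτ, ρ.vonNeumannEntropy_eq_tsum k hp,
    σ.vonNeumannEntropy_eq_tsum k hr, ← mul_add,
    tsum_ofReal_negMulLog_mul (ρ.nonneg_of_diagonal hp) (ρ.le_one_of_diagonal hp)
      (σ.nonneg_of_diagonal hr) (σ.le_one_of_diagonal hr) (ρ.tsum_of_diagonal hp)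
      (σ.tsum_of_diagonal hr)]

theorem State.vonNeumannEntropy_pow (k : ℝ) {ρ : A.State} {n : ℕ} {τ : (A.pow n).State}
    (h : τ.op = powOp ρ.op n) :
    τ.vonNeumannEntropy k = ((n + 1 : ℕ) : ℝ≥0∞) * ρ.vonNeumannEntropy k := by
  obtain ⟨ι, b, p, -, hp, -⟩ := ρ.exists_eigenbasis
  have hτ : ∀ I, τ.op (powBasis b n I) = ((∏ k, p (I k) : ℝ) : ℂ) • powBasis b n I := by
    intro I
    rw [h, powBasis_apply, powOp_powVec hp]
    push_cast
    rfl
  rw [τ.vonNeumannEntropy_eq_tsum k hτ, ρ.vonNeumannEntropy_eq_tsum k hp,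
    (tsum_ofReal_negMulLog_prod (ρ.nonneg_of_diagonal hp) (ρ.le_one_of_diagonal hp)
      (ρ.tsum_of_diagonal hp) n).2]
  ring

/-- `U` carries an eigenbasis of `ρ` to an eigenbasis of `σ` with the same eigenvalues. -/
theorem State.vonNeumannEntropy_unitary (k : ℝ) {ρ σ : A.State} {U : A.H →L[ℂ] A.H}
    (hU : U ∈ unitary (A.H →L[ℂ] A.H)) (h : σ.op = U * ρ.op * star U) :
    ρ.vonNeumannEntropy k = σ.vonNeumannEntropy k := by
  obtain ⟨ι, b, p, -, hp, -⟩ := ρ.exists_eigenbasis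
  have h1 : ∀ x, star U (U x) = x := fun x =>
    congrArg (fun T : A.H →L[ℂ] A.H => T x) (Unitary.star_mul_self_of_mem hU)
  have h2 : ∀ x, U (star U x) = x := fun x =>
    congrArg (fun T : A.H →L[ℂ] A.H => T x) (Unitary.mul_star_self_of_mem hU)
  have hinner : ∀ x y, ⟪U x, y⟫_ℂ = ⟪x, star U y⟫_ℂ := fun x y => by
    rw [ContinuousLinearMap.star_eq_adjoint, ContinuousLinearMap.adjoint_inner_right]
  let c : HilbertBasis ι ℂ A.H := HilbertBasis.mkOfOrthogonalEqBot (v := fun i => U (b i))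
    (by
      classical
      rw [orthonormal_iff_ite]
      intro i j
      rw [hinner, h1, orthonormal_iff_ite.1 b.orthonormal])
    (by
      rw [Submodule.eq_bot_iff]
      intro x hx
      have h3 : ∀ i, ⟪b i, star U x⟫_ℂ = 0 := fun i => by
        rw [← hinner]
        exact (Submodule.mem_orthogonal _ _).1 hx _ (Submodule.subset_span ⟨i, rfl⟩)
      have h4 : star U x = 0 := by
        refine b.repr.injective ?_
        ext i
        rw [b.repr_apply_apply, h3]
        simp
      rw [← h2 x, h4, map_zero])
  have hc : ∀ i, c i = U (b i) := fun i => by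
    simp only [c, HilbertBasis.coe_mkOfOrthogonalEqBot]
  have hσ : ∀ i, σ.op (c i) = (p i : ℂ) • c i := fun i => by
    rw [h, hc, mul_apply_eq_comp, mul_apply_eq_comp, h1, hp, map_smul]
  rw [ρ.vonNeumannEntropy_eq_tsum k hp, σ.vonNeumannEntropy_eq_tsum k hσ]

end QSystem

/-! ### Counting words with prescribed letter frequencies -/

section Types

/-- Gibbs' inequality against the product distribution P(I) = ∏ p (I k). From ln x ≤ x - 1 and N W ≤
1, the sum of W ln(N P) is at most the sum of P - W, which is 0. By the marginals, the same sum
equals ln N minus n times the entropy of p. -/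
theorem log_le_sum_negMulLog_of_marginals {ι : Type*} [DecidableEq ι] (n : ℕ) (s : Finset ι)
    (p : ι → ℝ)
    (hp : ∀ i ∈ s, 0 < p i) (hp1 : ∑ i ∈ s, p i = 1) {N : ℕ} (hN : 0 < N)
    (W : (Fin n → ι) → ℝ) (hW0 : ∀ I, 0 ≤ W I) (hW : ∀ I, N * W I ≤ 1)
    (hW1 : ∑ I ∈ Fintype.piFinset fun _ => s, W I = 1)
    (hm : ∀ k, ∀ i ∈ s, ∑ I ∈ Fintype.piFinset fun _ => s, (if I k = i then W I else 0) = p i) :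
    Real.log N ≤ n * ∑ i ∈ s, (p i).negMulLog := by
  have hN' : (0 : ℝ) < N := by exact_mod_cast hN
  have hpos : ∀ I ∈ Fintype.piFinset fun _ : Fin n => s, 0 < ∏ k, p (I k) := fun I hI =>
    Finset.prod_pos fun k _ => hp _ (Fintype.mem_piFinset.1 hI k)
  have h1 : ∑ I ∈ Fintype.piFinset (fun _ : Fin n => s), W I * Real.log (N * ∏ k, p (I k)) ≤ 0 := by
    calc ∑ I ∈ Fintype.piFinset (fun _ : Fin n => s), W I * Real.log (N * ∏ k, p (I k))
        ≤ ∑ I ∈ Fintype.piFinset (fun _ : Fin n => s), (∏ k, p (I k) - W I) := by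
          refine Finset.sum_le_sum fun I hI => ?_
          have h2 := Real.log_le_sub_one_of_pos (mul_pos hN' (hpos I hI))
          have h3 := mul_le_mul_of_nonneg_left h2 (hW0 I)
          have h4 := mul_le_mul_of_nonneg_right (hW I) (hpos I hI).le
          linarith
      _ = 0 := by
          rw [Finset.sum_sub_distrib, hW1, ← Finset.prod_univ_sum (fun _ => s) (fun _ => p)]
          simp [hp1]
  have h2 : ∀ k, ∑ I ∈ Fintype.piFinset (fun _ : Fin n => s), W I * Real.log (p (I k)) =
      ∑ i ∈ s, p i * Real.log (p i) := by
    intro k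
    calc ∑ I ∈ Fintype.piFinset (fun _ : Fin n => s), W I * Real.log (p (I k))
        = ∑ I ∈ Fintype.piFinset (fun _ : Fin n => s),
            ∑ i ∈ s, (if I k = i then W I else 0) * Real.log (p i) := by
          refine Finset.sum_congr rfl fun I hI => ?_
          simp_rw [ite_mul, zero_mul]
          rw [Finset.sum_ite_eq, if_pos (Fintype.mem_piFinset.1 hI k)]
      _ = _ := by
          rw [Finset.sum_comm]
          refine Finset.sum_congr rfl fun i hi => ?_
          rw [← Finset.sum_mul, hm k i hi]
  have h3 : ∑ I ∈ Fintype.piFinset (fun _ : Fin n => s), W I * Real.log (N * ∏ k, p (I k)) =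
      Real.log N + n * ∑ i ∈ s, p i * Real.log (p i) := by
    calc ∑ I ∈ Fintype.piFinset (fun _ : Fin n => s), W I * Real.log (N * ∏ k, p (I k))
        = ∑ I ∈ Fintype.piFinset (fun _ : Fin n => s),
            (W I * Real.log N + ∑ k, W I * Real.log (p (I k))) := by
          refine Finset.sum_congr rfl fun I hI => ?_
          rw [Real.log_mul hN'.ne' (hpos I hI).ne', Real.log_prod fun k _ =>
            (hp _ (Fintype.mem_piFinset.1 hI k)).ne', mul_add, Finset.mul_sum]
      _ = _ := by
          rw [Finset.sum_add_distrib, ← Finset.sum_mul, hW1, one_mul, Finset.sum_comm]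
          simp_rw [h2]
          simp
  simp only [Real.negMulLog, neg_mul, Finset.sum_neg_distrib]
  linarith

/-- Stirling's upper bound up to an error of order ln m, which division by the word length removes.
The induction step is ln(1 + 1/m) ≥ 1/(m + 1). -/
theorem Real.log_factorial_le {m : ℕ} (hm : m ≠ 0) :
    Real.log (m.factorial : ℝ) ≤ m * Real.log m - m + Real.log m + 1 := by
  induction m, Nat.one_le_iff_ne_zero.2 hm using Nat.le_induction with
  | base => simp
  | succ m h1 ih =>
    have hm0 : (0 : ℝ) < m := by exact_mod_cast h1
    have ih := ih (by omega)
    rw [Nat.factorial_succ, Nat.cast_mul, Real.log_mul (by positivity) (by positivity)]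
    push_cast
    have h2 := Real.one_sub_inv_le_log_of_pos (x := ((m : ℝ) + 1) / m) (by positivity)
    rw [Real.log_div (by positivity) (by positivity)] at h2
    have h3 : 1 - (((m : ℝ) + 1) / m)⁻¹ = 1 / (m + 1) := by
      field_simp
      ring
    rw [h3, div_le_iff₀ (by positivity)] at h2
    nlinarith

theorem Real.mul_log_sub_le_log_factorial (n : ℕ) :
    n * Real.log n - n ≤ Real.log (n.factorial : ℝ) := by
  rcases eq_or_ne n 0 with rfl | hn
  · simp
  have h1 : (1 : ℝ) ≤ n := by exact_mod_cast Nat.one_le_iff_ne_zero.2 hn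
  have h := Stirling.le_log_factorial_stirling hn
  have h2 : 0 ≤ Real.log n := Real.log_nonneg h1
  have h3 : 0 ≤ Real.log (2 * Real.pi) := Real.log_nonneg (by linarith [Real.pi_gt_three])
  linarith

variable {κ : Type*} [DecidableEq κ]

/-- All rearrangements of a word. -/
def wordOrbit {n : ℕ} (J : Fin n → κ) : Finset (Fin n → κ) :=
  Finset.univ.image fun g : Equiv.Perm (Fin n) => J ∘ g

theorem mem_wordOrbit {n : ℕ} {J I : Fin n → κ} :
    I ∈ wordOrbit J ↔ ∃ g : Equiv.Perm (Fin n), J ∘ g = I := by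
  simp [wordOrbit]

theorem comp_mem_wordOrbit {n : ℕ} {J I : Fin n → κ} (h : I ∈ wordOrbit J)
    (g : Equiv.Perm (Fin n)) : I ∘ g ∈ wordOrbit J := by
  obtain ⟨g', rfl⟩ := mem_wordOrbit.1 h
  exact mem_wordOrbit.2 ⟨g' * g, rfl⟩

theorem wordOrbit_nonempty {n : ℕ} (J : Fin n → κ) : (wordOrbit J).Nonempty :=
  ⟨J, mem_wordOrbit.2 ⟨1, rfl⟩⟩

/-- Orbit–stabiliser: each fibre of `g ↦ J ∘ g` is a translate of the stabiliser of `J`, which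
permutes the positions of each letter separately. -/
theorem card_wordOrbit [Fintype κ] {n : ℕ} (J : Fin n → κ) :
    (wordOrbit J).card * ∏ i, (Fintype.card {a // J a = i}).factorial = n.factorial := by
  rw [← DomMulAct.stabilizer_card J]
  have h := Finset.card_eq_sum_card_image (fun g : Equiv.Perm (Fin n) => J ∘ g) Finset.univ
  rw [Finset.card_univ, Fintype.card_perm, Fintype.card_fin] at h
  rw [h, ← smul_eq_mul]
  refine (Finset.sum_const _).symm.trans (Finset.sum_congr rfl fun I hI => ?_)
  obtain ⟨g₀, -, rfl⟩ := Finset.mem_image.1 hI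
  rw [← Fintype.card_coe]
  refine Fintype.card_congr ((Equiv.mulRight g₀).subtypeEquiv fun g => ?_)
  simp only [Finset.mem_filter, Finset.mem_univ, true_and, Equiv.coe_mulRight, Equiv.Perm.coe_mul,
    ← Function.comp_assoc]
  exact (g₀.surjective.right_cancellable).symm

/-- Swapping positions shows that the count does not depend on `k`. Counting the pairs of a position
and a word with letter `i` there in two ways then gives the identity. -/
theorem card_filter_wordOrbit {n : ℕ} (J : Fin n → κ) (k : Fin n) (i : κ) :
    n * ((wordOrbit J).filter fun I => I k = i).card =
      Fintype.card {a // J a = i} * (wordOrbit J).card := by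
  have h1 : ∀ k', ((wordOrbit J).filter fun I => I k' = i).card =
      ((wordOrbit J).filter fun I => I k = i).card := by
    intro k'
    refine Finset.card_bij (fun I _ => I ∘ Equiv.swap k k') ?_ ?_ ?_
    · intro I hI
      rw [Finset.mem_filter] at hI ⊢
      exact ⟨comp_mem_wordOrbit hI.1 _, by simpa using hI.2⟩
    · intro I _ I' _ h
      exact (Equiv.surjective _).injective_comp_right h
    · intro I hI
      rw [Finset.mem_filter] at hI
      refine ⟨I ∘ Equiv.swap k k', ?_, ?_⟩
      · rw [Finset.mem_filter]
        exact ⟨comp_mem_wordOrbit hI.1 _, by simpa using hI.2⟩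
      · funext x
        simp
  have h2 : ∑ k', ((wordOrbit J).filter fun I => I k' = i).card =
      ∑ I ∈ wordOrbit J, (Finset.univ.filter fun k' => I k' = i).card :=
    Finset.sum_card_bipartiteAbove_eq_sum_card_bipartiteBelow fun (k' : Fin n) (I : Fin n → κ) => I k' = i
  have h3 : ∀ I ∈ wordOrbit J, (Finset.univ.filter fun k' => I k' = i).card =
      Fintype.card {a // J a = i} := by
    intro I hI
    obtain ⟨g, rfl⟩ := mem_wordOrbit.1 hI
    rw [← Fintype.card_coe]
    exact Fintype.card_congr (g.subtypeEquiv fun a => by simp)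
  rw [Finset.sum_congr rfl h3] at h2
  simp_rw [h1] at h2
  simpa [mul_comm] using h2

theorem exists_word [Fintype κ] (m : κ → ℕ) {n : ℕ} (h : ∑ i, m i = n) :
    ∃ J : Fin n → κ, ∀ i, Fintype.card {a // J a = i} = m i := by
  have e : Fin n ≃ Σ i, Fin (m i) := Fintype.equivOfCardEq (by simp [h])
  refine ⟨fun a => (e a).1, fun i => ?_⟩
  rw [← Fintype.card_fin (m i)]
  exact Fintype.card_congr ((e.subtypeEquiv fun _ => Iff.rfl).trans (Equiv.sigmaSubtype i))

/-- The orbit has n! / ∏ (n p i)! elements; the factorial bounds cost at most ln n + 1 per letter.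
-/
theorem le_log_card_wordOrbit [Fintype κ] {n : ℕ} (hn : n ≠ 0) (J : Fin n → κ) (p : κ → ℝ)
    (hp : ∀ i, 0 < p i) (hp1 : ∑ i, p i = 1)
    (hJ : ∀ i, (Fintype.card {a // J a = i} : ℝ) = n * p i) :
    n * ∑ i, (p i).negMulLog - Fintype.card κ * (Real.log n + 1) ≤
      Real.log (wordOrbit J).card := by
  have hn0 : (0 : ℝ) < n := by exact_mod_cast Nat.pos_of_ne_zero hn
  have h := congrArg (fun x : ℕ => Real.log x) (card_wordOrbit J)
  have hc : ((wordOrbit J).card : ℝ) ≠ 0 := by exact_mod_cast (wordOrbit_nonempty J).card_ne_zero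
  simp only [Nat.cast_mul, Nat.cast_prod] at h
  rw [Real.log_mul hc (Finset.prod_ne_zero_iff.2 fun i _ => by positivity),
    Real.log_prod fun i _ => by positivity] at h
  have h1 := Real.mul_log_sub_le_log_factorial n
  have h2 : ∀ i, Real.log ((Fintype.card {a // J a = i}).factorial : ℝ) ≤
      n * (p i * Real.log n) - n * (p i).negMulLog - n * p i + (Real.log n + 1) := by
    intro i
    have hm : Fintype.card {a // J a = i} ≠ 0 := by
      intro h0
      have := hJ i
      rw [h0] at this
      simp only [Nat.cast_zero] at this
      exact (mul_pos hn0 (hp i)).ne this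
    refine (Real.log_factorial_le hm).trans ?_
    rw [hJ, Real.log_mul hn0.ne' (hp i).ne', Real.negMulLog]
    have hle : p i ≤ 1 := hp1 ▸ Finset.single_le_sum (fun j _ => (hp j).le) (Finset.mem_univ i)
    have := Real.log_nonpos (hp i).le hle
    linarith
  have h3 := Finset.sum_le_sum fun i (_ : i ∈ Finset.univ) => h2 i
  simp only [Finset.sum_add_distrib, Finset.sum_sub_distrib, ← Finset.mul_sum, ← Finset.sum_mul,
    hp1, Finset.sum_const, Finset.card_univ, nsmul_eq_mul] at h3
  linarith

/-- The length is L (t + 1), which makes all frequencies integral; t is taken so large that the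
Stirling error per letter position is below the gap between `c` and the entropy. -/
theorem exists_wordOrbit [Fintype κ] (p : κ → ℝ) (hp : ∀ i, 0 < p i) (hp1 : ∑ i, p i = 1)
    {L : ℕ} (hL : 0 < L) (hint : ∀ i, ∃ m : ℕ, L * p i = m) {c : ℝ}
    (hc : c < ∑ i, (p i).negMulLog) :
    ∃ (n : ℕ) (J : Fin (n + 1) → κ), L ∣ n + 1 ∧
      (n + 1 : ℕ) * c ≤ Real.log (wordOrbit J).card ∧
      ∀ k i, (((wordOrbit J).filter fun I => I k = i).card : ℝ) = p i * (wordOrbit J).card := by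
  choose m hm using hint
  have hL0 : (0 : ℝ) < L := by exact_mod_cast hL
  have hmL : ∑ i, m i = L := by
    have : ((∑ i, m i : ℕ) : ℝ) = L := by
      push_cast
      simp_rw [← hm]
      rw [← Finset.mul_sum, hp1, mul_one]
    exact_mod_cast this
  have hlim : Tendsto (fun t : ℕ => Fintype.card κ *
      ((Real.log ((L * (t + 1) : ℕ) : ℝ) + 1) / ((L * (t + 1) : ℕ) : ℝ))) atTop (𝓝 0) := by
    have h1 : Tendsto (fun x : ℝ => (Real.log x + 1) / x) atTop (𝓝 0) := by
      have := Real.isLittleO_log_id_atTop.tendsto_div_nhds_zero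
      have h2 := this.add (tendsto_inv_atTop_zero (𝕜 := ℝ))
      simpa [add_div] using h2
    have h2 : Tendsto (fun t : ℕ => L * (t + 1)) atTop atTop :=
      (tendsto_add_atTop_nat 1).const_mul_atTop' hL
    have h3 := (h1.comp (tendsto_natCast_atTop_atTop.comp h2)).const_mul (Fintype.card κ : ℝ)
    simpa [Function.comp_def] using h3
  obtain ⟨t, ht⟩ := (hlim.eventually_lt_const (sub_pos.2 hc)).exists
  obtain ⟨n, hn⟩ : ∃ n, L * (t + 1) = n + 1 :=
    Nat.exists_eq_succ_of_ne_zero (Nat.mul_pos hL t.succ_pos).ne'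
  obtain ⟨J, hJ⟩ := exists_word (fun i => (t + 1) * m i) (n := n + 1)
    (by rw [← Finset.mul_sum, hmL, mul_comm, hn])
  have hJ' : ∀ i, (Fintype.card {a // J a = i} : ℝ) = (n + 1 : ℕ) * p i := by
    intro i
    rw [hJ, ← hn]
    push_cast
    rw [← hm]
    ring
  refine ⟨n, J, ⟨t + 1, hn.symm⟩, ?_, fun k i => ?_⟩
  · have h1 := le_log_card_wordOrbit n.succ_ne_zero J p hp hp1 hJ'
    refine le_trans ?_ h1
    rw [hn] at ht
    have hn0 : (0 : ℝ) < (n + 1 : ℕ) := by positivity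
    rw [← mul_div_assoc, div_lt_iff₀ hn0] at ht
    linarith
  · have h1 := card_filter_wordOrbit J k i
    have h2 : ((n + 1 : ℕ) : ℝ) * ((wordOrbit J).filter fun I => I k = i).card =
        (n + 1 : ℕ) * (p i * (wordOrbit J).card) := by
      rw [← mul_assoc, ← hJ']
      exact_mod_cast h1
    exact mul_left_cancel₀ (by positivity) h2

end Types

/-! ### Rational combinatorics for von Neumann's entropy -/

namespace QSystem

variable {α : Type v} {A : QSystem.{v, u} α} {ι : Type*}

theorem _root_.HilbertBasis.ext_clm {H : Type*} [NormedAddCommGroup H] [InnerProductSpace ℂ H]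
    (b : HilbertBasis ι ℂ H) {T R : H →L[ℂ] H} (h : ∀ i, T (b i) = R (b i)) : T = R := by
  refine ContinuousLinearMap.ext_on (s := Set.range b)
    (Submodule.dense_iff_topologicalClosure_eq_top.2 b.dense_span) ?_
  rintro _ ⟨i, rfl⟩
  exact h i

theorem sum_rankOne_apply_basis [DecidableEq ι] (b : HilbertBasis ι ℂ A.H) (s : Finset ι)
    (c : ι → ℂ) (i : ι) :
    (∑ j ∈ s, c j • InnerProductSpace.rankOne ℂ (b j) (b j)) (b i) =
      (if i ∈ s then c i else 0) • b i := by
  simp only [sum_apply, smul_apply, InnerProductSpace.rankOne_apply,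
    orthonormal_iff_ite.1 b.orthonormal, ite_smul, one_smul, zero_smul, smul_ite, smul_zero,
    Finset.sum_ite_eq']

theorem eq_sum_rankOne_of_diagonal (b : HilbertBasis ι ℂ A.H) {T : A.H →L[ℂ] A.H} {c : ι → ℂ}
    (hT : ∀ i, T (b i) = c i • b i) (s : Finset ι) (hs : ∀ i ∉ s, c i = 0) :
    T = ∑ j ∈ s, c j • InnerProductSpace.rankOne ℂ (b j) (b j) := by
  classical
  refine b.ext_clm fun i => ?_
  rw [hT, sum_rankOne_apply_basis]
  split_ifs with hi
  · rfl
  · rw [hs i hi]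

theorem exists_eq_of_hasEigenvalue (b : HilbertBasis ι ℂ A.H) {T : A.H →L[ℂ] A.H}
    (hsa : IsSelfAdjoint T) {p : ι → ℝ} (hT : ∀ i, T (b i) = (p i : ℂ) • b i) {μ : ℂ}
    (hμ : Module.End.HasEigenvalue T.toLinearMap μ) : ∃ i, μ = p i := by
  obtain ⟨x, hx⟩ := hμ.exists_hasEigenvector
  have hx1 : T x = μ • x := hx.apply_eq_smul
  by_contra! hne
  refine hx.2 (b.repr.injective ?_)
  ext i
  have h1 : ⟪b i, T x⟫_ℂ = ⟪T (b i), x⟫_ℂ :=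
    (ContinuousLinearMap.isSelfAdjoint_iff_isSymmetric.1 hsa (b i) x).symm
  rw [hx1, hT, inner_smul_right, inner_smul_left, Complex.conj_ofReal] at h1
  rw [b.repr_apply_apply, map_zero]
  have h2 : (μ - p i) * ⟪b i, x⟫_ℂ = 0 := by rw [sub_mul, h1, sub_self]
  exact (mul_eq_zero.1 h2).resolve_left (sub_ne_zero.2 (hne i))

theorem State.hasEigenvalue_of_diagonal {ρ : A.State} {b : HilbertBasis ι ℂ A.H} {p : ι → ℝ}
    (hp : ∀ i, ρ.op (b i) = (p i : ℂ) • b i) (i : ι) :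
    Module.End.HasEigenvalue ρ.op.toLinearMap (p i : ℂ) :=
  Module.End.hasEigenvalue_of_hasEigenvector
    ⟨Module.End.mem_eigenspace_iff.2 (hp i), b.orthonormal.ne_zero i⟩

theorem State.IsRational.finite_support {ρ : A.State} (h : ρ.IsRational)
    {b : HilbertBasis ι ℂ A.H} {p : ι → ℝ} (hp : ∀ i, ρ.op (b i) = (p i : ℂ) • b i) :
    {i | p i ≠ 0}.Finite := by
  have := h.1
  let f : {i | p i ≠ 0} → LinearMap.range ρ.op.toLinearMap := fun i =>
    ⟨b i, (p i : ℂ)⁻¹ • b i, by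
      have h0 : (p i : ℂ) ≠ 0 := by exact_mod_cast i.2
      rw [map_smul]
      change (p i : ℂ)⁻¹ • ρ.op (b i) = b i
      rw [hp, smul_smul, inv_mul_cancel₀ h0, one_smul]⟩
  have hf : LinearIndependent ℂ f := by
    refine LinearIndependent.of_comp (LinearMap.range ρ.op.toLinearMap).subtype ?_
    exact (b.orthonormal.comp ((↑) : {i | p i ≠ 0} → ι) Subtype.val_injective).linearIndependent
  exact Set.finite_coe_iff.1 hf.finite

theorem State.vonNeumannEntropy_eq_sum {ρ : A.State} (k : ℝ) {b : HilbertBasis ι ℂ A.H}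
    {p : ι → ℝ} (hp : ∀ i, ρ.op (b i) = (p i : ℂ) • b i) (s : Finset ι) (hs : ∀ i ∉ s, p i = 0) :
    ρ.vonNeumannEntropy k =
      ENNReal.ofReal k * ENNReal.ofReal (∑ i ∈ s, (p i).negMulLog) := by
  rw [ρ.vonNeumannEntropy_eq_tsum k hp,
    ENNReal.ofReal_sum_of_nonneg fun i _ => ρ.negMulLog_nonneg_of_diagonal hp i,
    tsum_eq_sum fun i hi => by simp [hs i hi]]

theorem State.sum_eq_one_of_diagonal {ρ : A.State} {b : HilbertBasis ι ℂ A.H}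
    {p : ι → ℝ} (hp : ∀ i, ρ.op (b i) = (p i : ℂ) • b i) (s : Finset ι) (hs : ∀ i ∉ s, p i = 0) :
    ∑ i ∈ s, p i = 1 :=
  (hasSum_sum_of_ne_finset_zero hs).unique (ρ.hasSum_of_diagonal hp)

theorem hasSum_inner_diagonal {H : Type*} [NormedAddCommGroup H] [InnerProductSpace ℂ H]
    (b : HilbertBasis ι ℂ H) {T : H →L[ℂ] H} {c : ι → ℂ} (hT : ∀ i, T (b i) = c i • b i) (x : H) :
    HasSum (fun i => c i * ((‖⟪b i, x⟫_ℂ‖ ^ 2 : ℝ) : ℂ)) ⟪x, T x⟫_ℂ := by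
  have h := ((b.hasSum_repr x).mapL T).mapL (innerSL ℂ x)
  refine (congrArg (HasSum · _) (funext fun i => ?_)).mpr h
  rw [map_smul, hT, b.repr_apply_apply, innerSL_apply_apply, inner_smul_right, inner_smul_right,
    ← inner_conj_symm x (b i)]
  have := RCLike.mul_conj ⟪b i, x⟫_ℂ
  rw [mul_left_comm, this]
  push_cast
  rfl

/-- The diagonal of Ω in the product eigenbasis is a distribution on words to which Gibbs'
inequality applies. -/
theorem State.IsQLB.log_le {ρ : A.State} {b : HilbertBasis ι ℂ A.H}
    {p : ι → ℝ} (hp : ∀ i, ρ.op (b i) = (p i : ℂ) • b i) (s : Finset ι)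
    (hs : ∀ i, i ∈ s ↔ p i ≠ 0) {n N : ℕ} {Ω : (A.pow n).State} (hΩ : Ω.IsQLB N)
    (hm : ∀ k, Ω.IsPartialTrace k ρ) :
    Real.log N ≤ (n + 1 : ℕ) * ∑ i ∈ s, (p i).negMulLog := by
  classical
  have hs0 : ∀ i ∉ s, p i = 0 := fun i hi => by simpa [hs] using hi
  have hN : (0 : ℝ) < N := by exact_mod_cast hΩ.pos
  obtain ⟨f, -, hf, -, hop⟩ := hΩ.exists_orthonormal
  -- The diagonal element of Ω at the word `I`.
  let W : (Fin (n + 1) → ι) → ℝ := fun I => ∑ j, (N : ℝ)⁻¹ * ‖⟪powBasis b n I, f j⟫_ℂ‖ ^ 2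
  have hW0 : ∀ I, 0 ≤ W I := fun I => Finset.sum_nonneg fun j _ => by positivity
  -- The partial trace condition is tested on the projector onto `b i`; its site operator selects
  -- the words with letter `i` at position `k`.
  have hmarg : ∀ k i, HasSum (fun I => if I k = i then W I else 0) (p i) := by
    intro k i
    let X := InnerProductSpace.rankOne ℂ (b i) (b i)
    have hX : ∀ j, X (b j) = (if j = i then (1 : ℂ) else 0) • b j := by
      intro j
      simp only [X, InnerProductSpace.rankOne_apply, orthonormal_iff_ite.1 b.orthonormal]
      by_cases hij : j = i
      · simp [hij]
      · simp [hij, Ne.symm hij]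
    have h1 := hm k X
    have hρ : opTrace (ρ.op * X) = p i := by
      rw [eq_sum_rankOne_of_diagonal b hp s fun j hj => by simp [hs0 j hj],
        opTrace_sum_smul_rankOne_mul]
      simp only [hX, inner_smul_right, orthonormal_iff_ite.1 b.orthonormal, if_true, mul_one,
        mul_ite, mul_zero]
      rw [Finset.sum_ite_eq']
      split_ifs with hi
      · rfl
      · simp [hs0 i hi]
    rw [hρ, hop, opTrace_sum_smul_rankOne_mul] at h1
    have hsite : ∀ I, siteOp X n k (powBasis b n I) =
        (if I k = i then (1 : ℂ) else 0) • powBasis b n I := fun I => by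
      rw [powBasis_apply]
      exact siteOp_powVec hX n k I
    have h2 := hasSum_sum fun j (_ : j ∈ Finset.univ) =>
      (hasSum_inner_diagonal (powBasis b n) hsite (f j)).mul_left ((N : ℂ)⁻¹)
    rw [h1] at h2
    rw [← Complex.hasSum_ofReal]
    refine (congrArg (HasSum · _) (funext fun I => ?_)).mpr h2
    by_cases hI : I k = i
    · simp [hI, W]
    · simp [hI]
  -- A letter of probability zero has marginal zero, so no word containing it carries weight.
  have hWs : ∀ I ∉ Fintype.piFinset (fun _ : Fin (n + 1) => s), W I = 0 := by
    intro I hI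
    rw [Fintype.mem_piFinset] at hI
    push Not at hI
    obtain ⟨k, hk⟩ := hI
    have h1 := hmarg k (I k)
    rw [hs0 _ hk, hasSum_zero_iff_of_nonneg] at h1
    · simpa using congrFun h1 I
    · intro J
      split_ifs
      · exact hW0 J
      · exact le_rfl
  have hmarg' : ∀ k, ∀ i ∈ s,
      ∑ I ∈ Fintype.piFinset fun _ => s, (if I k = i then W I else 0) = p i := by
    intro k i _
    refine (hasSum_sum_of_ne_finset_zero fun I hI => ?_).unique (hmarg k i)
    simp [hWs I hI]
  refine log_le_sum_negMulLog_of_marginals (n + 1) s p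
    (fun i hi => lt_of_le_of_ne (ρ.nonneg_of_diagonal hp i) (Ne.symm ((hs i).1 hi)))
    (ρ.sum_eq_one_of_diagonal hp s hs0) hΩ.pos W hW0 (fun I => ?_) ?_ hmarg'
  · rw [Finset.mul_sum]
    -- Bessel's inequality for the unit vector `powBasis b n I` gives N W ≤ 1.
    have h1 := hf.sum_inner_products_le (powBasis b n I) (s := Finset.univ)
    rw [(powBasis b n).orthonormal.1, one_pow] at h1
    refine le_trans (le_of_eq (Finset.sum_congr rfl fun j _ => ?_)) h1
    rw [← mul_assoc, mul_inv_cancel₀ hN.ne', one_mul, ← inner_conj_symm, RCLike.norm_conj]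
  · rw [← ρ.sum_eq_one_of_diagonal hp s hs0, ← Finset.sum_congr rfl (hmarg' 0)]
    refine Eq.trans ?_ Finset.sum_comm
    refine Finset.sum_congr rfl fun I hI => ?_
    rw [Finset.sum_ite_eq, if_pos (Fintype.mem_piFinset.1 hI 0)]

/-- Ω is uniform on the product vectors of one word orbit. They share a sector since the total
charge ignores the order of letters, and the exact letter frequencies make every one-site marginal
equal to ρ. -/
theorem State.exists_isQLB_partialTrace {ρ : A.State} {b : HilbertBasis ι ℂ A.H}
    {p : ι → ℝ} (hp : ∀ i, ρ.op (b i) = (p i : ℂ) • b i) {q : ι → α → ℝ}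
    (hq : ∀ i, b i ∈ A.sector (q i)) (s : Finset ι) (hs : ∀ i, i ∈ s ↔ p i ≠ 0) {L : ℕ}
    (hL : 0 < L) (hint : ∀ i ∈ s, ∃ m : ℕ, L * p i = m) {c : ℝ}
    (hc : c < ∑ i ∈ s, (p i).negMulLog) :
    ∃ (n N : ℕ) (Ω : (A.pow n).State), L ∣ n + 1 ∧ Ω.IsQLB N ∧
      (∀ k, Ω.IsPartialTrace k ρ) ∧ (n + 1 : ℕ) * c ≤ Real.log N := by
  classical
  have hs0 : ∀ i ∉ s, p i = 0 := fun i hi => by simpa [hs] using hi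
  have hsum := ρ.sum_eq_one_of_diagonal hp s hs0
  rw [← Finset.sum_coe_sort s] at hsum hc
  obtain ⟨n, J, hdvd, hlog, hcount⟩ := exists_wordOrbit (fun i : s => p i)
    (fun i => lt_of_le_of_ne (ρ.nonneg_of_diagonal hp i) (Ne.symm ((hs i).1 i.2))) hsum hL
    (fun i => hint i i.2) hc
  let f : s → A.H := fun i => b i
  have hf : Orthonormal ℂ f := b.orthonormal.comp _ Subtype.val_injective
  obtain ⟨Ω, hΩ, hop⟩ := exists_isQLB_of_orthonormal (orthonormal_powVec hf n) (wordOrbit J)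
    (wordOrbit_nonempty J) (q := ∑ k, q (J k)) (fun I hI => by
      obtain ⟨g, rfl⟩ := mem_wordOrbit.1 hI
      have := powVec_mem_sector (f := f) (q := fun i : s => q i) (fun i => hq i) n (J ∘ g)
      rwa [Function.comp_def, Equiv.sum_comp g fun k => q (J k)] at this)
  refine ⟨n, _, Ω, hdvd, hΩ, fun k X => ?_, hlog⟩
  have hcard : ((wordOrbit J).card : ℂ) ≠ 0 := by
    exact_mod_cast (wordOrbit_nonempty J).card_ne_zero
  rw [hop, opTrace_sum_smul_rankOne_mul,
    eq_sum_rankOne_of_diagonal b hp s fun j hj => by simp [hs0 j hj],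
    opTrace_sum_smul_rankOne_mul, ← Finset.sum_coe_sort s]
  simp_rw [inner_siteOp_powVec hf]
  rw [← Finset.sum_fiberwise_of_maps_to (t := Finset.univ) (g := fun I => I k)
    fun _ _ => Finset.mem_univ _]
  refine Finset.sum_congr rfl fun i _ => ?_
  have h1 : ∀ I ∈ (wordOrbit J).filter fun I => I k = i,
      ((wordOrbit J).card : ℂ)⁻¹ * ⟪f (I k), X (f (I k))⟫_ℂ =
        ((wordOrbit J).card : ℂ)⁻¹ * ⟪f i, X (f i)⟫_ℂ := fun I hI => by
    rw [(Finset.mem_filter.1 hI).2]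
  rw [Finset.sum_congr rfl h1, Finset.sum_const, nsmul_eq_mul]
  have h2 : (((wordOrbit J).filter fun I => I k = i).card : ℂ) = p i * (wordOrbit J).card := by
    exact_mod_cast congrArg (fun x : ℝ => (x : ℂ)) (hcount k i)
  rw [h2]
  field_simp
  rfl

theorem State.IsRational.vonNeumannEntropy_eq_sSup {ρ : A.State} (h : ρ.IsRational) {k : ℝ}
    (hk : 0 ≤ k) :
    ρ.vonNeumannEntropy k = sSup {s | ∃ (n : ℕ) (Ω : (A.pow n).State) (N : ℕ),
      ρ.IsCommonDenominator (n + 1) ∧ Ω.IsQLB N ∧ (∀ k, Ω.IsPartialTrace k ρ) ∧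
        s = Ω.vonNeumannEntropy k / ((n + 1 : ℕ) : ℝ≥0∞)} := by
  obtain ⟨ι, b, p, q, hp, hq⟩ := ρ.exists_eigenbasis
  let s := (h.finite_support hp).toFinset
  have hs : ∀ i, i ∈ s ↔ p i ≠ 0 := fun i => by simp [s]
  have hs0 : ∀ i ∉ s, p i = 0 := fun i hi => by simpa [hs] using hi
  rw [ρ.vonNeumannEntropy_eq_sum k hp s hs0]
  refine le_antisymm ?_ (sSup_le ?_)
  · choose r hr using fun i => h.2 _ (ρ.hasEigenvalue_of_diagonal hp i)
    have hr' : ∀ i, p i = r i := fun i => by exact_mod_cast hr i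
    let L := ∏ i ∈ s, (r i).den
    have hL : 0 < L := Finset.prod_pos fun i _ => (r i).den_pos
    have hdiv : ∀ i ∈ s, (r i).den ∣ L := fun i hi => Finset.dvd_prod_of_mem _ hi
    have hint : ∀ i ∈ s, ∃ m : ℕ, L * p i = m := by
      intro i hi
      obtain ⟨t, ht⟩ := hdiv i hi
      have h0 : 0 ≤ r i := by
        have := ρ.nonneg_of_diagonal hp i
        rw [hr'] at this
        exact_mod_cast this
      have h1 : (r i).num.toNat = (r i).num := Int.toNat_of_nonneg (Rat.num_nonneg.2 h0)
      have h2 : r i * (r i).den = ((r i).num.toNat : ℚ) := by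
        rw [Rat.mul_den_eq_num]
        exact_mod_cast h1.symm
      refine ⟨t * (r i).num.toNat, ?_⟩
      rw [hr', ht]
      have h3 : (r i : ℝ) * (r i).den = ((r i).num.toNat : ℝ) := by exact_mod_cast h2
      push_cast
      rw [← h3]
      ring
    rw [← ENNReal.ofReal_mul hk]
    set H := ∑ i ∈ s, (p i).negMulLog
    have hlim : Tendsto (fun c : ℝ => ENNReal.ofReal (k * c)) (𝓝[<] H)
        (𝓝 (ENNReal.ofReal (k * H))) :=
      (ENNReal.continuous_ofReal.comp (continuous_const.mul continuous_id)).continuousWithinAt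
    -- The word construction only reaches values `c` below the entropy, so the bound is obtained as
    -- `c` tends to it from the left.
    refine le_of_tendsto hlim ?_
    filter_upwards [self_mem_nhdsWithin] with c hc
    obtain ⟨n, N, Ω, hdvd, hΩ, hpt, hlog⟩ := ρ.exists_isQLB_partialTrace hp hq s hs hL hint hc
    refine le_trans ?_ (le_sSup ⟨n, Ω, N, ?_, hΩ, hpt, rfl⟩)
    · rw [hΩ.vonNeumannEntropy_eq, ENNReal.le_div_iff_mul_le (by simp) (by simp),
        ← ENNReal.ofReal_mul hk, ← ENNReal.ofReal_natCast, ← ENNReal.ofReal_mul' (by positivity)]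
      refine ENNReal.ofReal_le_ofReal ?_
      rw [mul_assoc, mul_comm c]
      exact mul_le_mul_of_nonneg_left hlog hk
    · intro x hx
      obtain ⟨i, hi⟩ := exists_eq_of_hasEigenvalue b ρ.isSelfAdjoint hp hx
      rw [hr i] at hi
      have hxi : x = r i := by exact_mod_cast hi
      rw [hxi]
      by_cases his : i ∈ s
      · exact (hdiv i his).trans hdvd
      -- Eigenvalues outside the support are 0, whose denominator 1 imposes no condition.
      · have : r i = 0 := by
          have h0 := hs0 i his
          rw [hr'] at h0
          exact_mod_cast h0
        rw [this]
        simp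
  · rintro _ ⟨n, Ω, N, -, hΩ, hpt, rfl⟩
    rw [hΩ.vonNeumannEntropy_eq, ENNReal.div_le_iff (by simp) (by simp), mul_assoc,
      ← ENNReal.ofReal_natCast (n + 1), ← ENNReal.ofReal_mul' (q := ((n + 1 : ℕ) : ℝ)) (by positivity)]
    gcongr
    rw [mul_comm]
    exact hΩ.log_le hp s hs hpt

end QSystem

/-! ### Rational approximation and semicontinuity -/

theorem exists_rat_negMulLog_lt {x : ℝ} (hx : 0 ≤ x) {γ : ℝ} (hγ : 0 < γ) :
    ∃ r : ℚ, 0 ≤ (r : ℝ) ∧ (r : ℝ) ≤ x ∧ x - r < γ ∧ (r : ℝ).negMulLog < x.negMulLog + γ := by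
  rcases hx.eq_or_lt with rfl | hx
  · exact ⟨0, by simp, by simp, by simpa using hγ, by simpa using hγ⟩
  have h1 : ∀ᶠ y in 𝓝 x, y.negMulLog < x.negMulLog + γ :=
    Real.continuous_negMulLog.continuousAt.eventually_lt_const (by linarith)
  obtain ⟨δ, hδ, h2⟩ := Metric.eventually_nhds_iff.1 h1
  obtain ⟨r, hr1, hr2⟩ := exists_rat_btwn
    (max_lt hx (by linarith [lt_min hδ hγ] : x - min δ γ < x))
  have h3 := (le_max_left _ _).trans_lt hr1
  have h4 := (le_max_right _ _).trans_lt hr1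
  refine ⟨r, h3.le, hr2.le, by linarith [min_le_right δ γ], h2 ?_⟩
  rw [Real.dist_eq, abs_sub_lt_iff]
  constructor <;> linarith [min_le_left δ γ]

/-- A probability distribution is approximated by finitely supported rational distributions whose
entropy is not much larger. -/
theorem exists_rational_approximation {ι : Type*} {p : ι → ℝ} (hp0 : ∀ i, 0 ≤ p i)
    (hp : HasSum p 1) {ε : ℝ} (hε : 0 < ε) :
    ∃ (F : Finset ι) (c : ι → ℚ), (∀ i, 0 ≤ (c i : ℝ)) ∧ (∀ i ∉ F, c i = 0) ∧
      ∑ i ∈ F, (c i : ℝ) = 1 ∧ ∑' i, ENNReal.ofReal |(c i : ℝ) - p i| ≤ ENNReal.ofReal ε ∧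
      ∑ i ∈ F, (c i : ℝ).negMulLog ≤ ∑ i ∈ F, (p i).negMulLog + ε := by
  classical
  -- The index `i₀` receives all the mass lost by truncation and rounding.
  obtain ⟨i₀, hi₀⟩ : ∃ i, 0 < p i := by
    by_contra! h
    have : p = 0 := funext fun i => le_antisymm (h i) (hp0 i)
    rw [this] at hp
    exact one_ne_zero (hp.unique hasSum_zero)
  have h1 : ∀ᶠ y in 𝓝 (p i₀), y.negMulLog < (p i₀).negMulLog + ε / 2 :=
    Real.continuous_negMulLog.continuousAt.eventually_lt_const (by linarith)
  obtain ⟨δ₀, hδ₀, h2⟩ := Metric.eventually_nhds_iff.1 h1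
  -- δ bounds the mass moved to `i₀`: `δ₀` controls the entropy there, and ε / 2 suffices for the ℓ¹
  -- distance, which is twice that mass.
  set δ := min δ₀ (ε / 2) with hδdef
  have hδ : 0 < δ := lt_min hδ₀ (by linarith)
  have h3 : ∀ᶠ F in atTop, 1 - δ / 2 < ∑ i ∈ F, p i :=
    hp.eventually_const_lt (by linarith)
  obtain ⟨F, hF, hi₀F⟩ := (h3.and (eventually_ge_atTop {i₀})).exists
  replace hi₀F : i₀ ∈ F := hi₀F (Finset.mem_singleton_self i₀)
  set G := F.erase i₀ with hG
  -- All roundings together cost less than δ / 2 in mass and less than ε / 2 in entropy.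
  set γ := min δ ε / (2 * (G.card + 1)) with hγdef
  have hcard : (0 : ℝ) < 2 * (G.card + 1) := by positivity
  have hγ : 0 < γ := div_pos (lt_min hδ hε) hcard
  have hγc : G.card * γ < min δ ε / 2 := by
    have : 2 * (G.card + 1) * γ = min δ ε := by
      rw [hγdef]
      field_simp
    nlinarith
  choose r hr0 hrp hrd hrη using fun i => exists_rat_negMulLog_lt (hp0 i) hγ
  let c : ι → ℚ := fun i => if i = i₀ then 1 - ∑ j ∈ G, r j else if i ∈ G then r i else 0
  have hc₀ : (c i₀ : ℝ) = 1 - ∑ j ∈ G, (r j : ℝ) := by simp [c]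
  have hcG : ∀ i ∈ G, c i = r i := fun i hi => by
    simp [c, hi, Finset.ne_of_mem_erase hi]
  have hcF : ∀ i ∉ F, c i = 0 := fun i hi => by
    have h4 : i ≠ i₀ := fun h => hi (h ▸ hi₀F)
    have h5 : i ∉ G := fun h => hi (Finset.mem_of_mem_erase h)
    simp [c, h4, h5]
  have hsplit : ∀ f : ι → ℝ, ∑ i ∈ F, f i = f i₀ + ∑ i ∈ G, f i := fun f =>
    (Finset.add_sum_erase F f hi₀F).symm
  have hsumc : ∑ i ∈ F, (c i : ℝ) = 1 := by
    have h4 : ∑ i ∈ G, (c i : ℝ) = ∑ i ∈ G, (r i : ℝ) :=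
      Finset.sum_congr rfl fun i hi => by rw [hcG i hi]
    rw [hsplit, hc₀, h4]
    ring
  have hFle : ∑ i ∈ F, p i ≤ 1 := sum_le_hasSum F (fun i _ => hp0 i) hp
  rw [hsplit] at hF hFle
  have hGle : ∑ i ∈ G, (r i : ℝ) ≤ ∑ i ∈ G, p i := Finset.sum_le_sum fun i _ => hrp i
  have hGge : ∑ i ∈ G, p i ≤ ∑ i ∈ G, (r i : ℝ) + G.card * γ := by
    rw [← nsmul_eq_mul, ← Finset.sum_const, ← Finset.sum_add_distrib]
    exact Finset.sum_le_sum fun i _ => by linarith [hrd i]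
  have hd0 : p i₀ ≤ c i₀ := by rw [hc₀]; linarith
  have hd1 : c i₀ - p i₀ < δ := by
    rw [hc₀]
    linarith [min_le_left δ ε]
  have hcp : ∀ i, i ≠ i₀ → (c i : ℝ) ≤ p i := by
    intro i hi
    by_cases hiG : i ∈ G
    · rw [hcG i hiG]; exact hrp i
    · simpa [c, hi, hiG] using hp0 i
  refine ⟨F, c, ?_, hcF, hsumc, ?_, ?_⟩
  · intro i
    rcases eq_or_ne i i₀ with rfl | hi
    · exact hi₀.le.trans hd0
    · by_cases hiG : i ∈ G
      · rw [hcG i hiG]; exact hr0 i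
      · simp [c, hi, hiG]
  · have hcs : HasSum (fun i => (c i : ℝ)) 1 := by
      rw [← hsumc]
      exact hasSum_sum_of_ne_finset_zero fun i hi => by simp [hcF i hi]
    have habs : HasSum (fun i => |(c i : ℝ) - p i|) (2 * (c i₀ - p i₀)) := by
      -- The differences `p - c` sum to 0 and are nonnegative away from `i₀`, so correcting the
      -- single term at `i₀` yields the sum of absolute values.
      have h4 := (hp.sub hcs).add (hasSum_ite_eq i₀ (2 * ((c i₀ : ℝ) - p i₀)))
      rw [sub_self, zero_add] at h4
      refine (congrArg (HasSum · _) (funext fun i => ?_)).mpr h4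
      split_ifs with hi
      · rw [hi, abs_of_nonneg (by linarith)]
        ring
      · rw [abs_of_nonpos (by linarith [hcp i hi])]
        ring
    rw [← ENNReal.ofReal_tsum_of_nonneg (fun i => abs_nonneg _) habs.summable, habs.tsum_eq]
    exact ENNReal.ofReal_le_ofReal (by linarith [min_le_right δ₀ (ε / 2)])
  · rw [hsplit, hsplit fun i => (p i).negMulLog]
    have h4 : (c i₀ : ℝ).negMulLog < (p i₀).negMulLog + ε / 2 := by
      refine h2 ?_
      rw [Real.dist_eq, abs_of_nonneg (by linarith)]
      exact hd1.trans_le (min_le_left _ _)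
    have h5 : ∑ i ∈ G, (c i : ℝ).negMulLog ≤ ∑ i ∈ G, (p i).negMulLog + G.card * γ := by
      rw [← nsmul_eq_mul, ← Finset.sum_const, ← Finset.sum_add_distrib]
      refine Finset.sum_le_sum fun i hi => ?_
      rw [hcG i hi]
      exact (hrη i).le
    linarith [min_le_right δ ε]

namespace QSystem

variable {α : Type v} {A : QSystem.{v, u} α} {ι : Type*}

/-- A supremum of continuous functions is lower semicontinuous. The diagonal sums over finite sets
are continuous in operator norm, since the spectra of all states lie in [0, 1], and the trace norm
dominates the operator norm. -/
theorem State.lowerSemicontinuous_vonNeumannEntropy (k : ℝ) (ρ : A.State) {c : ℝ≥0∞}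
    (hc : c < ρ.vonNeumannEntropy k) :
    ∃ δ > 0, ∀ σ : A.State, traceNorm (σ.op - ρ.op) < δ → c < σ.vonNeumannEntropy k := by
  let b := stdHilbertBasis A.H
  let g : A.State → Finset (stdHilbertIndex A.H) → ℝ≥0∞ := fun σ F => ENNReal.ofReal k *
    ∑ i ∈ F, ENNReal.ofReal (RCLike.re ⟪b i, cfc Real.negMulLog σ.op (b i)⟫_ℂ)
  have hg : ∀ σ : A.State, σ.vonNeumannEntropy k = ⨆ F, g σ F := fun σ => by
    rw [σ.vonNeumannEntropy_eq_tsum_inner k b, ENNReal.tsum_eq_iSup_sum, ENNReal.mul_iSup]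
  rw [hg, lt_iSup_iff] at hc
  obtain ⟨F, hF⟩ := hc
  let l : Filter A.State := comap (fun σ : A.State => σ.op) (𝓝 ρ.op)
  have h1 : Tendsto (fun σ : A.State => cfc Real.negMulLog σ.op) l
      (𝓝 (cfc Real.negMulLog ρ.op)) :=
    tendsto_comap.cfc isCompact_Icc Real.negMulLog
      (Eventually.of_forall fun σ => σ.spectrum_subset)
      (Eventually.of_forall fun σ => σ.isSelfAdjoint) ρ.spectrum_subset ρ.isSelfAdjoint
      Real.continuous_negMulLog.continuousOn
  have h2 : Tendsto (fun σ => g σ F) l (𝓝 (g ρ F)) := by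
    refine ENNReal.Tendsto.const_mul (tendsto_finsetSum _ fun i _ => ?_)
      (Or.inr ENNReal.ofReal_ne_top)
    have hcont : Continuous fun T : A.H →L[ℂ] A.H =>
        ENNReal.ofReal (RCLike.re ⟪b i, T (b i)⟫_ℂ) := by
      refine ENNReal.continuous_ofReal.comp (RCLike.continuous_re.comp ?_)
      exact continuous_const.inner (ContinuousLinearMap.apply ℂ A.H (b i)).continuous
    exact (hcont.tendsto _).comp h1
  obtain ⟨t, ht, hsub⟩ := mem_comap.1 (h2.eventually_const_lt hF)
  obtain ⟨ε, hε, hball⟩ := Metric.mem_nhds_iff.1 ht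
  refine ⟨ENNReal.ofReal ε, ENNReal.ofReal_pos.2 hε, fun σ hσ => ?_⟩
  have hn := (ofReal_opNorm_le_traceNorm (σ.op - ρ.op)).trans_lt hσ
  rw [ENNReal.ofReal_lt_ofReal_iff hε] at hn
  have h3 : c < g σ F := hsub (hball (mem_ball_iff_norm.2 hn))
  rw [hg]
  exact h3.trans_le (le_iSup _ F)

/-- The approximation is made in a sector-adapted eigenbasis of `ρ`: σ is then block-diagonal, and
the trace norm of the difference is the ℓ¹ distance of the eigenvalues. -/
theorem State.exists_isRational_near (k : ℝ) (ρ : A.State) {ε : ℝ} (hε : 0 < ε) :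
    ∃ σ : A.State, σ.IsRational ∧ traceNorm (σ.op - ρ.op) ≤ ENNReal.ofReal ε ∧
      σ.vonNeumannEntropy k ≤ ρ.vonNeumannEntropy k + ENNReal.ofReal k * ENNReal.ofReal ε := by
  classical
  obtain ⟨ι, b, p, q, hp, hq⟩ := ρ.exists_eigenbasis
  obtain ⟨F, c, hc0, hcF, hsum, htr, hent⟩ :=
    exists_rational_approximation (ρ.nonneg_of_diagonal hp) (ρ.hasSum_of_diagonal hp) hε
  obtain ⟨σ, hσ⟩ := exists_state_of_orthonormal b.orthonormal hq F (fun i _ => hc0 i) hsum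
  have hσb : ∀ i, σ.op (b i) = ((c i : ℝ) : ℂ) • b i := by
    intro i
    rw [hσ, sum_rankOne_apply_basis]
    split_ifs with hi
    · rfl
    · simp [hcF i hi]
  refine ⟨σ, ⟨?_, ?_⟩, ?_, ?_⟩
  · have hle : LinearMap.range σ.op.toLinearMap ≤ Submodule.span ℂ (F.image b : Set A.H) := by
      rintro _ ⟨x, rfl⟩
      change σ.op x ∈ _
      rw [hσ, sum_apply]
      refine Submodule.sum_mem _ fun i hi => ?_
      rw [smul_apply, InnerProductSpace.rankOne_apply]
      refine Submodule.smul_mem _ _ (Submodule.smul_mem _ _ (Submodule.subset_span ?_))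
      exact Finset.mem_coe.2 (Finset.mem_image_of_mem b hi)
    exact Submodule.finiteDimensional_of_le hle
  · intro μ hμ
    obtain ⟨i, hi⟩ := exists_eq_of_hasEigenvalue b σ.isSelfAdjoint hσb hμ
    exact ⟨c i, by rw [hi]; simp⟩
  · have hsub : ∀ i, (σ.op - ρ.op) (b i) = (((c i : ℝ) - p i : ℝ) : ℂ) • b i := fun i => by
      rw [sub_apply, hσb, hp, ← sub_smul]
      push_cast
      rfl
    have hpos := (ContinuousLinearMap.nonneg_iff_isPositive _).1 (CFC.abs_nonneg (σ.op - ρ.op))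
    rw [traceNorm, posTrace_eq_tsum hpos b]
    refine le_trans (le_of_eq (tsum_congr fun i => ?_)) htr
    rw [cfcAbs_apply_eq_smul (σ.isSelfAdjoint.sub ρ.isSelfAdjoint) (hsub i), inner_smul_right,
      inner_self_eq_norm_sq_to_K, b.orthonormal.1 i]
    simp
  · rw [σ.vonNeumannEntropy_eq_sum k hσb F fun i hi => by simp [hcF i hi],
      ρ.vonNeumannEntropy_eq_tsum k hp, ← mul_add]
    gcongr
    refine (ENNReal.ofReal_le_ofReal hent).trans ?_
    have hη := ρ.negMulLog_nonneg_of_diagonal hp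
    rw [ENNReal.ofReal_add (Finset.sum_nonneg fun i _ => hη i) hε.le,
      ENNReal.ofReal_sum_of_nonneg fun i _ => hη i]
    gcongr
    exact ENNReal.sum_le_tsum F

/-- Lower semicontinuity keeps every such limit above the entropy of `ρ`; along the approximations
with error 1 / (n + 1) the limit equals it, so the infimum is attained. -/
theorem State.vonNeumannEntropy_eq_sInf (k : ℝ) (ρ : A.State) :
    ρ.vonNeumannEntropy k = sInf {s | ∃ σ : ℕ → A.State, (∀ n, (σ n).IsRational) ∧
      Tendsto (fun n => traceNorm ((σ n).op - ρ.op)) atTop (𝓝 0) ∧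
      Tendsto (fun n => (σ n).vonNeumannEntropy k) atTop (𝓝 s)} := by
  have hlsc : ∀ σ : ℕ → A.State, Tendsto (fun n => traceNorm ((σ n).op - ρ.op)) atTop (𝓝 0) →
      ∀ c < ρ.vonNeumannEntropy k, ∀ᶠ n in atTop, c < (σ n).vonNeumannEntropy k := by
    intro σ hσ c hc
    obtain ⟨δ, hδ, h⟩ := ρ.lowerSemicontinuous_vonNeumannEntropy k hc
    exact (hσ.eventually_lt_const hδ).mono fun n hn => h _ hn
  refine le_antisymm (le_sInf ?_) (sInf_le ?_)
  · rintro s ⟨σ, -, hσ, hs⟩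
    refine le_of_forall_lt fun c hc => ?_
    obtain ⟨d, hcd, hd⟩ := exists_between hc
    exact hcd.trans_le (ge_of_tendsto hs ((hlsc σ hσ d hd).mono fun n hn => hn.le))
  · choose σ hr ht he using fun n : ℕ =>
      ρ.exists_isRational_near k (ε := 1 / ((n : ℝ) + 1)) (by positivity)
    have hε : Tendsto (fun n : ℕ => ENNReal.ofReal (1 / ((n : ℝ) + 1))) atTop (𝓝 0) := by
      rw [← ENNReal.ofReal_zero]
      exact (ENNReal.continuous_ofReal.tendsto 0).comp tendsto_one_div_add_atTop_nhds_zero_nat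
    have ht' : Tendsto (fun n => traceNorm ((σ n).op - ρ.op)) atTop (𝓝 0) :=
      tendsto_of_tendsto_of_tendsto_of_le_of_le tendsto_const_nhds hε (fun _ => zero_le) ht
    refine ⟨σ, hr, ht', tendsto_order.2 ⟨hlsc σ ht', fun c hc => ?_⟩⟩
    have hup : Tendsto (fun n : ℕ => ρ.vonNeumannEntropy k +
        ENNReal.ofReal k * ENNReal.ofReal (1 / ((n : ℝ) + 1))) atTop
        (𝓝 (ρ.vonNeumannEntropy k)) := by
      have := (ENNReal.Tendsto.const_mul hε (Or.inr (ENNReal.ofReal_ne_top (r := k)))).const_add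
        (ρ.vonNeumannEntropy k)
      simpa using this
    exact (hup.eventually_lt_const hc).mono fun n hn => (he n).trans_lt hn

end QSystem

/-! ### Powers and existence of QLB states -/

theorem exists_nat_div_between {x y : ℝ} (hx : 0 ≤ x) (hxy : x < y) :
    ∃ n m : ℕ, x * (n + 1 : ℕ) < (m + 1 : ℕ) ∧ ((m + 1 : ℕ) : ℝ) < y * (n + 1 : ℕ) := by
  obtain ⟨r, hr1, hr2⟩ := exists_rat_btwn hxy
  have hr0 : 0 < r := by exact_mod_cast hx.trans_lt hr1
  obtain ⟨n, hn⟩ := Nat.exists_eq_succ_of_ne_zero r.den_ne_zero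
  obtain ⟨m, hm⟩ := Int.eq_succ_of_zero_lt (Rat.num_pos.2 hr0)
  have hd : (0 : ℝ) < (n + 1 : ℕ) := by positivity
  have h : (r : ℝ) * (n + 1 : ℕ) = (m + 1 : ℕ) := by
    have h1 := Rat.mul_den_eq_num r
    rw [hn, hm] at h1
    exact_mod_cast h1
  exact ⟨n, m, h ▸ mul_lt_mul_of_pos_right hr1 hd, h ▸ mul_lt_mul_of_pos_right hr2 hd⟩

namespace QSystem

variable {α : Type v} {A : QSystem.{v, u} α}

/-- The N ^ (n + 1) product vectors all have total charge (n + 1) q, so they lie in a single sector.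
-/
theorem State.IsQLB.exists_pow {ρ : A.State} {N : ℕ} (h : ρ.IsQLB N) (n : ℕ) :
    ∃ τ : (A.pow n).State, τ.op = powOp ρ.op n ∧ τ.IsQLB (N ^ (n + 1)) := by
  have hN := h.pos
  obtain ⟨f, q, hf, hq, hop⟩ := h.exists_orthonormal
  have : NeZero N := ⟨hN.ne'⟩
  obtain ⟨τ, hτ, hτop⟩ := exists_isQLB_of_orthonormal (orthonormal_powVec hf n) Finset.univ
    Finset.univ_nonempty fun I _ => powVec_mem_sector (q := fun _ => q) hq n I
  rw [Finset.card_univ, Fintype.card_fun, Fintype.card_fin, Fintype.card_fin] at hτ hτop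
  refine ⟨τ, ?_, hτ⟩
  rw [hτop, hop, powOp_sum_rankOne]
  simp

theorem exists_isQLB_of_infinite {q : α → ℝ} (hq : ¬ FiniteDimensional ℂ (A.sector q)) {N : ℕ}
    (hN : 0 < N) : ∃ Ω : A.State, Ω.IsQLB N := by
  have : CompleteSpace (A.sector q) := (A.isClosed_sector q).completeSpace_coe
  have hinf : Infinite (stdHilbertIndex (A.sector q)) := by
    by_contra hfin
    rw [not_infinite_iff_finite] at hfin
    have := Fintype.ofFinite (stdHilbertIndex (A.sector q))
    exact hq (stdHilbertBasis (A.sector q)).toOrthonormalBasis.toBasis.finiteDimensional_of_finite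
  obtain ⟨s, hs⟩ := Infinite.exists_subset_card_eq (stdHilbertIndex (A.sector q)) N
  obtain ⟨Ω, hΩ, -⟩ := exists_isQLB_of_orthonormal
    ((stdHilbertBasis (A.sector q)).orthonormal.comp_linearIsometry (A.sector q).subtypeₗᵢ) s
    (Finset.card_pos.1 (hs ▸ hN)) fun i _ => (stdHilbertBasis (A.sector q) i).2
  exact ⟨Ω, hs ▸ hΩ⟩

theorem pow_mem {𝒞 : Set (QSystem.{v, u} α)} (h : ∀ A ∈ 𝒞, ∀ B ∈ 𝒞, A.tensor B ∈ 𝒞)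
    (hA : A ∈ 𝒞) (n : ℕ) : A.pow n ∈ 𝒞 := by
  induction n with
  | zero => exact hA
  | succ n ih => exact h _ ih _ hA

end QSystem

/-! ### The axioms and von Neumann's entropy -/

namespace EntropyFunction

open QSystem

variable {α : Type v} {𝒞 : Set (QSystem.{v, u} α)} {S : EntropyFunction.{v, u} α}

theorem satisfiesAxioms_of_eq_vonNeumannEntropy
    (hC : ∀ A ∈ 𝒞, ∀ B ∈ 𝒞, A.tensor B ∈ 𝒞) {k : ℝ} (hk : 0 < k)
    (hS : ∀ A ∈ 𝒞, ∀ ρ : A.State, S A ρ = ρ.vonNeumannEntropy k) : S.SatisfiesAxioms 𝒞 where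
  decomposition := by
    intro A hA B hB ρ σ τ h
    rw [hS _ (hC A hA B hB), hS A hA, hS B hB, State.vonNeumannEntropy_tensor k h]
    exact ⟨fun hσ => by rw [hσ.vonNeumannEntropy_eq, add_zero],
      fun hρ => by rw [hρ.vonNeumannEntropy_eq, zero_add]⟩
  unitaryInvariance := by
    intro A hA ρ σ U hU _ h
    rw [hS A hA, hS A hA, State.vonNeumannEntropy_unitary k hU h]
  monotonicity := by
    intro A hA B hB ρ σ M N hρ hσ hNM
    have hN : (0 : ℝ) < N := by exact_mod_cast hσ.pos
    have h1N : (1 : ℝ) ≤ N := by exact_mod_cast hσ.pos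
    have hNM' : (N : ℝ) < M := by exact_mod_cast hNM
    rw [hS A hA, hS B hB, hρ.vonNeumannEntropy_eq, hσ.vonNeumannEntropy_eq,
      ← ENNReal.ofReal_mul hk.le, ← ENNReal.ofReal_mul hk.le, ENNReal.ofReal_lt_ofReal_iff]
    · exact mul_lt_mul_of_pos_left (Real.log_lt_log hN hNM') hk
    · exact mul_pos hk (Real.log_pos (h1N.trans_lt hNM'))
  extensivity := by
    intro A hA ρ n τ h
    rw [hS A hA, hS _ (pow_mem hC hA n), State.vonNeumannEntropy_pow k h]
  rationalCombinatorics := by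
    intro A hA ρ hρ
    rw [hS A hA, hρ.vonNeumannEntropy_eq_sSup hk.le]
    simp_rw [fun n => hS _ (pow_mem hC hA n)]
  semicontinuity := by
    refine ⟨fun A hA ρ c hc => ?_, fun A hA ρ => ?_⟩
    · rw [hS A hA] at hc
      simp_rw [hS A hA]
      exact ρ.lowerSemicontinuous_vonNeumannEntropy k hc
    · simp_rw [hS A hA]
      exact ρ.vonNeumannEntropy_eq_sInf k

namespace SatisfiesAxioms

theorem mul_lt_mul_of_isQLB (h : S.SatisfiesAxioms 𝒞)
    (hC : ∀ A ∈ 𝒞, ∀ B ∈ 𝒞, A.tensor B ∈ 𝒞) {A B : QSystem.{v, u} α} (hA : A ∈ 𝒞) (hB : B ∈ 𝒞)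
    {ρ : A.State} {σ : B.State} {M N m n : ℕ} (hρ : ρ.IsQLB N) (hσ : σ.IsQLB M)
    (hlt : N ^ (n + 1) < M ^ (m + 1)) :
    ((n + 1 : ℕ) : ℝ≥0∞) * S A ρ < ((m + 1 : ℕ) : ℝ≥0∞) * S B σ := by
  obtain ⟨τ, hτ, hτN⟩ := hρ.exists_pow n
  obtain ⟨ω, hω, hωM⟩ := hσ.exists_pow m
  rw [← h.extensivity A hA ρ n τ hτ, ← h.extensivity B hB σ m ω hω]
  exact h.monotonicity _ (pow_mem hC hB m) _ (pow_mem hC hA n) ω τ _ _ hωM hτN hlt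

/-- The ratio of S(π(N)) to S(π(2)) has the same rational upper and lower bounds as ln N / ln 2, by
comparing powers. -/
theorem exists_const_isQLB (h : S.SatisfiesAxioms 𝒞)
    (hC : ∀ A ∈ 𝒞, ∀ B ∈ 𝒞, A.tensor B ∈ 𝒞)
    (hinf : ∃ A ∈ 𝒞, ∃ q : α → ℝ, ¬ FiniteDimensional ℂ (A.sector q)) :
    ∃ k : ℝ, 0 < k ∧ ∀ A ∈ 𝒞, ∀ (ρ : A.State) (N : ℕ), ρ.IsQLB N →
      S A ρ = ρ.vonNeumannEntropy k := by
  obtain ⟨A₀, hA₀, q, hq⟩ := hinf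
  have hex : ∀ N : ℕ, 0 < N → ∃ Ω : A₀.State, Ω.IsQLB N := fun N hN =>
    exists_isQLB_of_infinite hq hN
  have hfin : ∀ A ∈ 𝒞, ∀ (ρ : A.State) (N : ℕ), ρ.IsQLB N → S A ρ ≠ ⊤ := by
    intro A hA ρ N hρ
    -- A strictly larger value is taken on some π(N + 1), so the value on π(N) is finite.
    obtain ⟨Ω, hΩ⟩ := hex (N + 1) N.succ_pos
    exact (h.monotonicity A₀ hA₀ A hA Ω ρ _ _ hΩ hρ N.lt_succ_self).ne_top
  have hlt : ∀ A ∈ 𝒞, ∀ B ∈ 𝒞, ∀ (ρ : A.State) (σ : B.State) (N M n m : ℕ), ρ.IsQLB N →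
      σ.IsQLB M → ((n + 1 : ℕ) : ℝ) * Real.log N < (m + 1 : ℕ) * Real.log M →
      ((n + 1 : ℕ) : ℝ) * (S A ρ).toReal < (m + 1 : ℕ) * (S B σ).toReal := by
    intro A hA B hB ρ σ N M n m hρ hσ hl
    have hN : (0 : ℝ) < N := by exact_mod_cast hρ.pos
    have hM : (0 : ℝ) < M := by exact_mod_cast hσ.pos
    rw [← Real.log_pow, ← Real.log_pow, Real.log_lt_log_iff (by positivity) (by positivity)] at hl
    have h1 := h.mul_lt_mul_of_isQLB hC hA hB hρ hσ (n := n) (m := m) (by exact_mod_cast hl)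
    have h2 := ENNReal.toReal_strict_mono
      (ENNReal.mul_ne_top (ENNReal.natCast_ne_top _) (hfin B hB σ M hσ)) h1
    rwa [ENNReal.toReal_mul, ENNReal.toReal_mul, ENNReal.toReal_natCast,
      ENNReal.toReal_natCast] at h2
  obtain ⟨Ω₁, hΩ₁⟩ := hex 1 one_pos
  obtain ⟨Ω, hΩ⟩ := hex 2 two_pos
  set e := (S A₀ Ω).toReal with he_def
  have hlog2 : 0 < Real.log (2 : ℕ) := by
    push_cast
    exact Real.log_pos one_lt_two
  have he : 0 < e := by
    have h1 := h.monotonicity A₀ hA₀ A₀ hA₀ Ω Ω₁ _ _ hΩ hΩ₁ one_lt_two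
    exact ENNReal.toReal_pos (zero_le.trans_lt h1).ne' (hfin A₀ hA₀ Ω 2 hΩ)
  refine ⟨e / Real.log (2 : ℕ), div_pos he hlog2, fun A hA ρ N hρ => ?_⟩
  have hN1 : (1 : ℝ) ≤ N := by exact_mod_cast hρ.pos
  rw [hρ.vonNeumannEntropy_eq, ← ENNReal.ofReal_mul (div_pos he hlog2).le,
    ← ENNReal.ofReal_toReal (hfin A hA ρ N hρ)]
  congr 1
  set x := (S A ρ).toReal with hx_def
  have hx : 0 ≤ x := ENNReal.toReal_nonneg
  have hl : 0 ≤ Real.log N := Real.log_nonneg hN1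
  suffices hs : x / e = Real.log N / Real.log (2 : ℕ) by
    field_simp at hs ⊢
    linarith
  -- A rational (m + 1) / (n + 1) strictly between the two ratios gives opposite strict inequalities
  -- for the powers and for S.
  rcases lt_trichotomy (x / e) (Real.log N / Real.log (2 : ℕ)) with hxl | heq | hxl
  · obtain ⟨n, m, h1, h2⟩ := exists_nat_div_between (div_nonneg hx he.le) hxl
    rw [div_mul_eq_mul_div, div_lt_iff₀ he] at h1
    rw [div_mul_eq_mul_div, lt_div_iff₀ hlog2] at h2
    have h3 := hlt A₀ hA₀ A hA Ω ρ 2 N m n hΩ hρ (by linarith)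
    linarith
  · exact heq
  · obtain ⟨n, m, h1, h2⟩ := exists_nat_div_between (div_nonneg hl hlog2.le) hxl
    rw [div_mul_eq_mul_div, div_lt_iff₀ hlog2] at h1
    rw [div_mul_eq_mul_div, lt_div_iff₀ he] at h2
    have h3 := hlt A hA A₀ hA₀ ρ Ω N 2 n m hρ hΩ (by linarith)
    linarith

/-- S and von Neumann's entropy satisfy the same formula on rational states in terms of QLB states,
and the same formula on all states in terms of rational ones, so agreement on QLB states spreads. -/
theorem exists_eq_vonNeumannEntropy (h : S.SatisfiesAxioms 𝒞)
    (hC : ∀ A ∈ 𝒞, ∀ B ∈ 𝒞, A.tensor B ∈ 𝒞)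
    (hinf : ∃ A ∈ 𝒞, ∃ q : α → ℝ, ¬ FiniteDimensional ℂ (A.sector q)) :
    ∃ k : ℝ, 0 < k ∧ ∀ A ∈ 𝒞, ∀ ρ : A.State, S A ρ = ρ.vonNeumannEntropy k := by
  obtain ⟨k, hk, hqlb⟩ := h.exists_const_isQLB hC hinf
  have hrat : ∀ A ∈ 𝒞, ∀ ρ : A.State, ρ.IsRational → S A ρ = ρ.vonNeumannEntropy k := by
    intro A hA ρ hρ
    rw [h.rationalCombinatorics A hA ρ hρ, hρ.vonNeumannEntropy_eq_sSup hk.le]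
    congr 1
    ext s
    refine exists_congr fun n => exists_congr fun Ω => exists_congr fun N => and_congr_right
      fun _ => and_congr_right fun hΩ => ?_
    rw [hqlb _ (pow_mem hC hA n) Ω N hΩ]
  refine ⟨k, hk, fun A hA ρ => ?_⟩
  rw [h.semicontinuity.2 A hA ρ, ρ.vonNeumannEntropy_eq_sInf k]
  congr 1
  ext s
  refine exists_congr fun σ => and_congr_right fun hσ => ?_
  simp_rw [fun n => hrat A hA (σ n) (hσ n)]

end SatisfiesAxioms

end EntropyFunction

theorem theorem2 {α : Type v} (𝒞 : Set (QSystem.{v, u} α))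
    (h_compound : ∀ A ∈ 𝒞, ∀ B ∈ 𝒞, A.tensor B ∈ 𝒞)
    (h_infinite : ∃ A ∈ 𝒞, ∃ q : α → ℝ, ¬ FiniteDimensional ℂ (A.sector q))
    (S : EntropyFunction.{v, u} α) :
    S.SatisfiesAxioms 𝒞 ↔
      ∃ k : ℝ, 0 < k ∧ ∀ A ∈ 𝒞, ∀ ρ : A.State, S A ρ = ρ.vonNeumannEntropy k :=
  ⟨fun h => h.exists_eq_vonNeumannEntropy h_compound h_infinite,
    fun ⟨_, hk, hS⟩ =>
      EntropyFunction.satisfiesAxioms_of_eq_vonNeumannEntropy h_compound hk hS⟩
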